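/- Let $n \geq 2$. Make the group algebra $\mathbb{C}S_n$ into a superalgebra ($\mathbb{Z}/2$-graded algebra) whose even and odd parts are spanned by the even and the odd permutations. For a partition $\lambda \vdash n$, let $\lambda'$ be its conjugate, let $S^\lambda$ be the Specht module (realized, for instance, as the left ideal of $\mathbb{C}S_n$ generated by the Young symmetrizer of a tableau of shape $\lambda$), and let $f^\lambda = \dim_{\mathbb{C}} S^\lambda$. Fix a set $\overline{\mathcal{P}}(n)$ of representatives for the classes $\{\lambda,\lambda'\}$ of partitions of $n$, and set $$E_n = \{\lambda \in \overline{\mathcal{P}}(n) : \lambda \neq \lambda'\}, \qquad F_n = \{\lambda \in \overline{\mathcal{P}}(n) : \lambda = \lambda'\}.$$ There exist linear isomorphisms $\phi^\lambda : S^\lambda \to S^{\lambda'}$ ($\lambda \vdash n$) such that $\phi^\lambda(\sigma v) = \operatorname{sgn}(\sigma)\, \sigma \phi^\lambda(v)$ for all $\sigma \in S_n$ and $v \in S^\lambda$, and $\phi^{\lambda'} \circ \phi^\lambda = \mathrm{id}_{S^\lambda}$. Fix any such family. For $\lambda \in E_n$ let $W^\lambda = S^\lambda \oplus S^{\lambda'}$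 with even part $\{u + \phi^\lambda(u) : u \in S^\lambda\}$ and odd part $\{u - \phi^\lambda(u) : u \in S^\lambda\}$, let $J^\lambda$ be the odd involution of $W^\lambda$ with $J^\lambda(u \pm \phi^\lambda(u)) = u \mp \phi^\lambda(u)$ for $u \in S^\lambda$, and let $Q(W^\lambda) = \{\theta \in \operatorname{End}_{\mathbb{C}}(W^\lambda) : J^\lambda \theta = \theta J^\lambda\}$. For $\lambda \in F_n$ let $W^\lambda = S^\lambda$ with even and odd parts the eigenspaces of $\phi^\lambda$ for the eigenvalues $1$ and $-1$. Then each $W^\lambda$ is a simple $\mathbb{C}S_n$-supermodule, which is reducible as an ungraded module if $\lambda \in E_n$ (Type Q) and simple as an ungraded module if $\lambda \in F_n$ (Type M). Moreover, $f^\lambda$ is even for $\lambda \in F_n$, and the map $\sigma \mapsto \bigoplus_{\lambda} W^\lambda(\sigma)$, where $W^\lambda(\sigma)$ is the action of $\sigma$ on $W^\lambda$, induces a superalgebra isomorphism $$\mathbb{C}S_n \cong \Big[\bigoplus_{\lambda \in E_n} Q(W^\lambda)\Big] \oplus \Big[\bigoplus_{\lambda \in F_n} \operatorname{End}(W^\lambda)\Big]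 \cong \Big[\bigoplus_{\lambda \in E_n} Q(f^\lambda)\Big] \oplus \Big[\bigoplus_{\lambda \in F_n} M(\tfrac12 f^\lambda | \tfrac12 f^\lambda)\Big],$$ where the second isomorphism is a direct sum of superalgebra isomorphisms $Q(W^\lambda) \cong Q(f^\lambda)$ and $\operatorname{End}(W^\lambda) \cong M(\tfrac12 f^\lambda | \tfrac12 f^\lambda)$. Here $M(m|m)$ is the superalgebra of block matrices $\begin{bmatrix} A & B \\ C & D \end{bmatrix}$ with $A,B,C,D \in M_m(\mathbb{C})$, with even part $B = C = 0$ and odd part $A = D = 0$, and $Q(m) \subseteq M(m|m)$ is the subsuperalgebra of the matrices $\begin{bmatrix} A & B \\ B & A \end{bmatrix}$. Consequently, if $\operatorname{Lie}(A)$ denotes a superalgebra $A$ considered as a Lie superalgebra via the super commutator $[x,y] = xy - (-1)^{\bar{x} \cdot \bar{y}} yx$, and if $\mathfrak{q}(W^\lambda)$, $\mathfrak{gl}(W^\lambda)$, $\mathfrak{q}(m)$, $\mathfrak{gl}(m|m)$ denote $Q(W^\lambda)$, $\operatorname{End}(W^\lambda)$, $Q(m)$, $M(m|m)$ considered as Lie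 superalgebras in this way, then the same maps are isomorphisms of Lie superalgebras $$\operatorname{Lie}(\mathbb{C}S_n) \cong \Big[\bigoplus_{\lambda \in E_n} \mathfrak{q}(W^\lambda)\Big] \oplus \Big[\bigoplus_{\lambda \in F_n} \mathfrak{gl}(W^\lambda)\Big] \cong \Big[\bigoplus_{\lambda \in E_n} \mathfrak{q}(f^\lambda)\Big] \oplus \Big[\bigoplus_{\lambda \in F_n} \mathfrak{gl}(\tfrac12 f^\lambda | \tfrac12 f^\lambda)\Big].$$ -/

import Mathlib

noncomputable section

namespace SymSuper

/-! ### Superspaces -/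

/-- A complex vector superspace: a vector space `V = V₀ ⊕ V₁` graded by `ℤ/2ℤ`. -/
class Superspace (V : Type*) [AddCommGroup V] [Module ℂ V] where
  /-- The homogeneous subspaces. -/
  part : ZMod 2 → Submodule ℂ V
  isCompl : IsCompl (part 0) (part 1)


theorem isCompl_of_decomp {V : Type*} [AddCommGroup V] [Module ℂ V] {p q : Submodule ℂ V}
    (h₁ : ∀ v, v ∈ p → v ∈ q → v = 0) (h₂ : ∀ v, ∃ a ∈ p, ∃ b ∈ q, a + b = v) : IsCompl p q :=
  ⟨Submodule.disjoint_def.2 h₁, codisjoint_iff.2 <| by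
    rw [eq_top_iff]
    intro v _
    exact Submodule.mem_sup.2 (h₂ v)⟩

section Superspace

variable {V : Type*} [AddCommGroup V] [Module ℂ V] [Superspace V]

theorem isCompl_part (i : ZMod 2) :
    IsCompl (Superspace.part (V := V) i) (Superspace.part (i + 1)) := by
  fin_cases i
  · exact Superspace.isCompl
  · exact Superspace.isCompl.symm

/-- The projection of a superspace onto its homogeneous subspace of degree `i`, along the other
homogeneous subspace. -/
def proj (i : ZMod 2) : V →ₗ[ℂ] V :=
  (Superspace.part i).projection (Superspace.part (i + 1)) (isCompl_part i)

theorem proj_mem (i : ZMod 2) (v : V) : proj i v ∈ Superspace.part (V := V) i :=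
  Submodule.projection_apply_mem _ _

theorem proj_of_mem {i : ZMod 2} {v : V} (hv : v ∈ Superspace.part (V := V) i) :
    proj i v = v :=
  Submodule.projection_apply_of_mem_left _ hv

theorem proj_of_mem_ne {i j : ZMod 2} (hij : i ≠ j) {v : V}
    (hv : v ∈ Superspace.part (V := V) j) : proj i v = 0 := by
  have h : j = i + 1 := (by decide : ∀ i j : ZMod 2, i ≠ j → j = i + 1) i j hij
  subst h
  exact (Submodule.projection_apply_eq_zero_iff _).2 hv

theorem proj_zero_add_proj_one (v : V) : proj 0 v + proj 1 v = v := by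
  obtain ⟨a, ha, b, hb, rfl⟩ : ∃ a ∈ Superspace.part (V := V) 0, ∃ b ∈ Superspace.part (V := V) 1,
      a + b = v := by
    apply Submodule.mem_sup.1
    rw [(Superspace.isCompl (V := V)).sup_eq_top]
    trivial
  simp [proj_of_mem ha, proj_of_mem hb, proj_of_mem_ne (i := 0) (j := 1) (by decide) hb,
    proj_of_mem_ne (i := 1) (j := 0) (by decide) ha]

theorem eq_zero_of_mem_both {v : V} (h₀ : v ∈ Superspace.part (V := V) 0)
    (h₁ : v ∈ Superspace.part (V := V) 1) : v = 0 :=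
  Submodule.disjoint_def.1 (Superspace.isCompl (V := V)).disjoint v h₀ h₁

end Superspace

theorem proj_eq {V : Type*} [AddCommGroup V] [Module ℂ V] [Superspace V] {i : ZMod 2} {v a : V}
    (h : a ∈ Superspace.part (V := V) i) (h' : v - a ∈ Superspace.part (V := V) (i + 1)) :
    proj i v = a := by
  have e : v = a + (v - a) := by abel
  have hne : i ≠ i + 1 := (by decide : ∀ i : ZMod 2, i ≠ i + 1) i
  rw [e, map_add, proj_of_mem h, proj_of_mem_ne hne h', add_zero]

/-- The direct product of a family of superspaces (their direct sum, for a finite family). -/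
instance piSuperspace {ι : Type*} (V : ι → Type*) [∀ k, AddCommGroup (V k)]
    [∀ k, Module ℂ (V k)] [∀ k, Superspace (V k)] : Superspace (∀ k, V k) where
  part i := Submodule.pi Set.univ fun k => Superspace.part (V := V k) i
  isCompl := by
    refine isCompl_of_decomp (fun v h₀ h₁ => ?_) (fun v => ?_)
    · funext k
      exact eq_zero_of_mem_both (h₀ k trivial) (h₁ k trivial)
    · exact ⟨fun k => proj 0 (v k), fun k _ => proj_mem 0 _, fun k => proj 1 (v k),
        fun k _ => proj_mem 1 _, funext fun k => proj_zero_add_proj_one (v k)⟩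

instance prodSuperspace (V W : Type*) [AddCommGroup V] [Module ℂ V] [Superspace V]
    [AddCommGroup W] [Module ℂ W] [Superspace W] : Superspace (V × W) where
  part i := (Superspace.part (V := V) i).prod (Superspace.part (V := W) i)
  isCompl := by
    refine isCompl_of_decomp (fun v h₀ h₁ => ?_) (fun v => ?_)
    · exact Prod.ext (eq_zero_of_mem_both h₀.1 h₁.1) (eq_zero_of_mem_both h₀.2 h₁.2)
    · exact ⟨(proj 0 v.1, proj 0 v.2), ⟨proj_mem 0 _, proj_mem 0 _⟩,
        (proj 1 v.1, proj 1 v.2), ⟨proj_mem 1 _, proj_mem 1 _⟩,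
        Prod.ext (proj_zero_add_proj_one v.1) (proj_zero_add_proj_one v.2)⟩

/-! ### Associative superalgebras -/

/-- An associative unital complex superalgebra. -/
class Superalgebra (A : Type*) [Ring A] [Algebra ℂ A] extends Superspace A where
  one_mem : (1 : A) ∈ part 0
  mul_mem : ∀ {i j : ZMod 2} {a b : A}, a ∈ part i → b ∈ part j → a * b ∈ part (i + j)

instance piSuperalgebra {ι : Type*} (A : ι → Type*) [∀ k, Ring (A k)] [∀ k, Algebra ℂ (A k)]
    [∀ k, Superalgebra (A k)] : Superalgebra (∀ k, A k) where
  toSuperspace := piSuperspace A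
  one_mem := fun _ _ => Superalgebra.one_mem
  mul_mem ha hb := fun k hk => Superalgebra.mul_mem (ha k hk) (hb k hk)

instance prodSuperalgebra (A B : Type*) [Ring A] [Algebra ℂ A] [Superalgebra A]
    [Ring B] [Algebra ℂ B] [Superalgebra B] : Superalgebra (A × B) where
  toSuperspace := prodSuperspace A B
  one_mem := ⟨Superalgebra.one_mem, Superalgebra.one_mem⟩
  mul_mem ha hb := ⟨Superalgebra.mul_mem ha.1 hb.1, Superalgebra.mul_mem ha.2 hb.2⟩

/-- A subalgebra that contains the homogeneous components of its elements is a superalgebra. -/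
abbrev Superalgebra.ofSubalgebra {A : Type*} [Ring A] [Algebra ℂ A] [Superalgebra A]
    (S : Subalgebra ℂ A) (hS : ∀ x ∈ S, ∀ i, proj i x ∈ S) : Superalgebra S where
  part i := (Superspace.part (V := A) i).comap S.val.toLinearMap
  isCompl := by
    refine isCompl_of_decomp (fun v h₀ h₁ => ?_) (fun v => ?_)
    · exact Subtype.ext (eq_zero_of_mem_both (V := A) h₀ h₁)
    · exact ⟨⟨proj 0 v.1, hS v.1 v.2 0⟩, proj_mem (V := A) 0 _,
        ⟨proj 1 v.1, hS v.1 v.2 1⟩, proj_mem (V := A) 1 _,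
        Subtype.ext (proj_zero_add_proj_one v.1)⟩
  one_mem := Superalgebra.one_mem (A := A)
  mul_mem ha hb := Superalgebra.mul_mem (A := A) ha hb

/-- An isomorphism of superalgebras: an even isomorphism of algebras. -/
structure SuperalgEquiv (A B : Type*) [Ring A] [Algebra ℂ A] [Superalgebra A]
    [Ring B] [Algebra ℂ B] [Superalgebra B] extends A ≃ₐ[ℂ] B where
  map_part : ∀ (i : ZMod 2) (a : A), a ∈ Superspace.part (V := A) i →
    toFun a ∈ Superspace.part (V := B) i

/-! ### The superalgebras `End(V)` and `Q(V, J)` -/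

/-- `End(V)`, where a homogeneous map of degree `i` shifts degrees by `i`. -/
instance endSuperalgebra (V : Type*) [AddCommGroup V] [Module ℂ V] [Superspace V] :
    Superalgebra (Module.End ℂ V) where
  part i :=
    { carrier := {f | ∀ j, ∀ v ∈ Superspace.part (V := V) j, f v ∈ Superspace.part (V := V) (i + j)}
      add_mem' := fun hf hg j v hv => add_mem (hf j v hv) (hg j v hv)
      zero_mem' := fun _ _ _ => zero_mem _
      smul_mem' := fun c _ hf j v hv => Submodule.smul_mem _ c (hf j v hv) }
  isCompl := by
    refine isCompl_of_decomp (fun f h₀ h₁ => ?_) (fun f => ?_)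
    · have key : ∀ j, ∀ v ∈ Superspace.part (V := V) j, f v = 0 := by
        intro j v hv
        have a := h₀ j v hv
        have b := h₁ j v hv
        fin_cases j
        · exact eq_zero_of_mem_both a b
        · exact eq_zero_of_mem_both b a
      ext v
      rw [← proj_zero_add_proj_one v, map_add, key 0 _ (proj_mem 0 v), key 1 _ (proj_mem 1 v)]
      simp
    · refine ⟨proj 0 ∘ₗ f ∘ₗ proj 0 + proj 1 ∘ₗ f ∘ₗ proj 1, ?_,
        proj 1 ∘ₗ f ∘ₗ proj 0 + proj 0 ∘ₗ f ∘ₗ proj 1, ?_, ?_⟩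
      · intro j v hv
        fin_cases j
        · have h := proj_of_mem_ne (i := 1) (j := 0) (by decide) hv
          simp only [LinearMap.add_apply, LinearMap.comp_apply, h, map_zero, add_zero]
          exact proj_mem (V := V) 0 _
        · have h := proj_of_mem_ne (i := 0) (j := 1) (by decide) hv
          simp only [LinearMap.add_apply, LinearMap.comp_apply, h, map_zero, zero_add]
          exact proj_mem (V := V) 1 _
      · intro j v hv
        fin_cases j
        · have h := proj_of_mem_ne (i := 1) (j := 0) (by decide) hv
          simp only [LinearMap.add_apply, LinearMap.comp_apply, h, map_zero, add_zero]
          exact proj_mem (V := V) 1 _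
        · have h := proj_of_mem_ne (i := 0) (j := 1) (by decide) hv
          simp only [LinearMap.add_apply, LinearMap.comp_apply, h, map_zero, zero_add]
          exact proj_mem (V := V) 0 _
      · ext v
        have e : f v = f (proj 0 v) + f (proj 1 v) := by
          rw [← map_add, proj_zero_add_proj_one]
        have e₀ := proj_zero_add_proj_one (f (proj 0 v))
        have e₁ := proj_zero_add_proj_one (f (proj 1 v))
        simp only [LinearMap.add_apply, LinearMap.comp_apply]
        calc _ = (proj 0 (f (proj 0 v)) + proj 1 (f (proj 0 v))) +
              (proj 0 (f (proj 1 v)) + proj 1 (f (proj 1 v))) := by abel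
          _ = f v := by rw [e₀, e₁, e]
  one_mem := fun j v hv => by simpa using hv
  mul_mem {i j f g} hf hg := fun k v hv => by
    have := hf _ _ (hg k v hv)
    rwa [← add_assoc] at this

/-- An odd involution `J` of a superspace: an odd linear map with `J ∘ J = id`. -/
structure OddInvolution (V : Type*) [AddCommGroup V] [Module ℂ V] [Superspace V] where
  toEnd : Module.End ℂ V
  odd : toEnd ∈ Superspace.part (V := Module.End ℂ V) 1
  sq : toEnd * toEnd = 1

/-- `Q(V, J)`: the endomorphisms of `V` that commute with `J`. -/
def QEnd {V : Type*} [AddCommGroup V] [Module ℂ V] [Superspace V] (J : OddInvolution V) :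
    Subalgebra ℂ (Module.End ℂ V) :=
  Subalgebra.centralizer ℂ {J.toEnd}

theorem commute_proj {A : Type*} [Ring A] [Algebra ℂ A] [Superalgebra A] {u x : A}
    (hu : u ∈ Superspace.part (V := A) 1) (hc : u * x = x * u) (i : ZMod 2) :
    u * proj i x = proj i x * u := by
  have hx := proj_zero_add_proj_one x
  have m₀ := proj_mem 0 x
  have m₁ := proj_mem 1 x
  generalize proj 0 x = a at *
  generalize proj 1 x = b at *
  subst hx
  have ha : u * a - a * u ∈ Superspace.part (V := A) 1 :=
    sub_mem (by simpa using Superalgebra.mul_mem hu m₀) (by simpa using Superalgebra.mul_mem m₀ hu)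
  have hb : u * b - b * u ∈ Superspace.part (V := A) 0 :=
    sub_mem (Superalgebra.mul_mem hu m₁) (Superalgebra.mul_mem m₁ hu)
  have hab : u * a - a * u = -(u * b - b * u) := by
    rw [mul_add, add_mul] at hc
    rw [eq_neg_iff_add_eq_zero, sub_add_sub_comm, hc, sub_self]
  have h₀ : u * a - a * u = 0 := eq_zero_of_mem_both (by rw [hab]; exact neg_mem hb) ha
  have h₁ : u * b - b * u = 0 := by rw [h₀] at hab; exact neg_eq_zero.1 hab.symm
  have hi : i = 0 ∨ i = 1 := (by decide : ∀ i : ZMod 2, i = 0 ∨ i = 1) i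
  rcases hi with rfl | rfl
  · rw [map_add, proj_of_mem m₀, proj_of_mem_ne (by decide) m₁, add_zero]
    exact sub_eq_zero.1 h₀
  · rw [map_add, proj_of_mem m₁, proj_of_mem_ne (by decide) m₀, zero_add]
    exact sub_eq_zero.1 h₁

instance qEndSuperalgebra {V : Type*} [AddCommGroup V] [Module ℂ V] [Superspace V]
    (J : OddInvolution V) : Superalgebra (QEnd J) :=
  Superalgebra.ofSubalgebra (QEnd J) <| by
    intro x hx i
    refine (Subalgebra.mem_centralizer_iff ℂ).2 ?_
    rintro _ rfl
    exact commute_proj J.odd ((Subalgebra.mem_centralizer_iff ℂ).1 hx _ rfl) i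

/-! ### The matrix superalgebras `M(m|n)` and `Q(n)` -/

/-- The degree of the rows and columns of a supermatrix. -/
def blockDeg {m n : ℕ} : Fin m ⊕ Fin n → ZMod 2 := Sum.elim (fun _ => 0) (fun _ => 1)

/-- `M(m|n)`: block matrices `[A B; C D]`. -/
abbrev MSuper (m n : ℕ) : Type := Matrix (Fin m ⊕ Fin n) (Fin m ⊕ Fin n) ℂ

/-- `[A 0; 0 D]` is even and `[0 B; C 0]` is odd. -/
instance mSuperalgebra (m n : ℕ) : Superalgebra (MSuper m n) where
  part i :=
    { carrier := {M | ∀ r c, blockDeg r + blockDeg c ≠ i → M r c = 0}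
      add_mem' := fun hM hN r c h => by simp [hM r c h, hN r c h]
      zero_mem' := fun _ _ _ => rfl
      smul_mem' := fun z M hM r c h => by simp [hM r c h] }
  isCompl := by
    refine isCompl_of_decomp (fun M h₀ h₁ => ?_) (fun M => ?_)
    · ext r c
      by_cases h : blockDeg r + blockDeg c = 0
      · exact h₁ r c (by rw [h]; decide)
      · exact h₀ r c h
    · refine ⟨fun r c => if blockDeg r + blockDeg c = 0 then M r c else 0, fun r c h => if_neg h,
        fun r c => if blockDeg r + blockDeg c = 0 then 0 else M r c, fun r c h => if_pos ?_, ?_⟩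
      · exact (by decide : ∀ x : ZMod 2, x ≠ 1 → x = 0) _ h
      · ext r c
        by_cases h : blockDeg r + blockDeg c = 0
        · exact (congrArg₂ (· + ·) (if_pos h) (if_pos h)).trans (add_zero _)
        · exact (congrArg₂ (· + ·) (if_neg h) (if_neg h)).trans (zero_add _)
  one_mem := fun r c h => by
    refine Matrix.one_apply_ne ?_
    rintro rfl
    exact h ((by decide : ∀ x : ZMod 2, x + x = 0) _)
  mul_mem {i j M N} hM hN := fun r c h => by
    rw [Matrix.mul_apply]
    refine Finset.sum_eq_zero fun k _ => ?_
    by_cases h₁ : blockDeg r + blockDeg k = i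
    · have h₂ : blockDeg k + blockDeg c ≠ j := by
        rintro rfl
        exact h ((by decide : ∀ x y z i : ZMod 2, x + y = i → x + z = i + (y + z)) _ _ _ _ h₁)
      rw [hN k c h₂, mul_zero]
    · rw [hM r k h₁, zero_mul]

/-- `Q(n)`: block matrices `[A B; B A]`. -/
def QSuper (n : ℕ) : Subalgebra ℂ (MSuper n n) where
  carrier := {M | ∃ A B : Matrix (Fin n) (Fin n) ℂ, M = Matrix.fromBlocks A B B A}
  add_mem' := by
    rintro _ _ ⟨A, B, rfl⟩ ⟨C, D, rfl⟩
    exact ⟨A + C, B + D, Matrix.fromBlocks_add ..⟩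
  mul_mem' := by
    rintro _ _ ⟨A, B, rfl⟩ ⟨C, D, rfl⟩
    refine ⟨A * C + B * D, A * D + B * C, ?_⟩
    rw [Matrix.fromBlocks_multiply, add_comm (B * C), add_comm (B * D)]
  algebraMap_mem' := by
    intro r
    refine ⟨r • 1, 0, ?_⟩
    rw [Algebra.algebraMap_eq_smul_one, ← Matrix.fromBlocks_one, Matrix.fromBlocks_smul, smul_zero]

instance qSuperalgebra (n : ℕ) : Superalgebra (QSuper n) :=
  Superalgebra.ofSubalgebra (QSuper n) <| by
    rintro _ ⟨A, B, rfl⟩ i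
    have h₀ : Matrix.fromBlocks A 0 0 A ∈ Superspace.part (V := MSuper n n) 0 := by
      rintro (r | r) (c | c) h <;> first | rfl | exact absurd rfl h
    have h₁ : Matrix.fromBlocks 0 B B 0 ∈ Superspace.part (V := MSuper n n) 1 := by
      rintro (r | r) (c | c) h <;> first | rfl | exact absurd rfl h
    have e : Matrix.fromBlocks A B B A =
        Matrix.fromBlocks A 0 0 A + Matrix.fromBlocks 0 B B 0 := by
      rw [Matrix.fromBlocks_add]; simp
    fin_cases i
    · refine ⟨A, 0, proj_eq (V := MSuper n n) h₀ ?_⟩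
      rw [e, add_sub_cancel_left]
      exact h₁
    · refine ⟨0, B, proj_eq (V := MSuper n n) h₁ ?_⟩
      rw [e, add_sub_cancel_right]
      exact h₀

/-! ### Lie superalgebras -/

/-- The sign `(-1)^{i j}`. -/
def ksign (i j : ZMod 2) : ℂ := (-1) ^ (i.val * j.val)

/-- A complex Lie superalgebra. -/
class LieSuperalgebra (L : Type*) [AddCommGroup L] [Module ℂ L] extends Superspace L where
  bracket : L →ₗ[ℂ] L →ₗ[ℂ] L
  bracket_mem : ∀ {i j : ZMod 2} {x y : L}, x ∈ part i → y ∈ part j → bracket x y ∈ part (i + j)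
  skew : ∀ {i j : ZMod 2} {x y : L}, x ∈ part i → y ∈ part j →
    bracket x y = -(ksign i j • bracket y x)
  jacobi : ∀ {i j k : ZMod 2} {x y z : L}, x ∈ part i → y ∈ part j → z ∈ part k →
    bracket x (bracket y z) = bracket (bracket x y) z + ksign i j • bracket y (bracket x z)

instance piLieSuperalgebra {ι : Type*} (L : ι → Type*) [∀ k, AddCommGroup (L k)]
    [∀ k, Module ℂ (L k)] [∀ k, LieSuperalgebra (L k)] : LieSuperalgebra (∀ k, L k) where
  toSuperspace := piSuperspace L
  bracket := LinearMap.mk₂ ℂ (fun x y k => LieSuperalgebra.bracket (x k) (y k))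
    (fun _ _ _ => by ext; simp) (fun _ _ _ => by ext; simp)
    (fun _ _ _ => by ext; simp) (fun _ _ _ => by ext; simp)
  bracket_mem hx hy := fun k hk => LieSuperalgebra.bracket_mem (hx k hk) (hy k hk)
  skew hx hy := funext fun k => LieSuperalgebra.skew (hx k trivial) (hy k trivial)
  jacobi hx hy hz :=
    funext fun k => LieSuperalgebra.jacobi (hx k trivial) (hy k trivial) (hz k trivial)

instance prodLieSuperalgebra (L M : Type*) [AddCommGroup L] [Module ℂ L] [LieSuperalgebra L]
    [AddCommGroup M] [Module ℂ M] [LieSuperalgebra M] : LieSuperalgebra (L × M) where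
  toSuperspace := prodSuperspace L M
  bracket := LinearMap.mk₂ ℂ
    (fun x y => (LieSuperalgebra.bracket x.1 y.1, LieSuperalgebra.bracket x.2 y.2))
    (fun _ _ _ => by ext <;> simp) (fun _ _ _ => by ext <;> simp)
    (fun _ _ _ => by ext <;> simp) (fun _ _ _ => by ext <;> simp)
  bracket_mem hx hy :=
    ⟨LieSuperalgebra.bracket_mem hx.1 hy.1, LieSuperalgebra.bracket_mem hx.2 hy.2⟩
  skew hx hy := Prod.ext (LieSuperalgebra.skew hx.1 hy.1) (LieSuperalgebra.skew hx.2 hy.2)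
  jacobi hx hy hz :=
    Prod.ext (LieSuperalgebra.jacobi hx.1 hy.1 hz.1) (LieSuperalgebra.jacobi hx.2 hy.2 hz.2)

/-- An isomorphism of Lie superalgebras: an even linear isomorphism that respects brackets. -/
structure LieSuperEquiv (L M : Type*) [AddCommGroup L] [Module ℂ L] [LieSuperalgebra L]
    [AddCommGroup M] [Module ℂ M] [LieSuperalgebra M] extends L ≃ₗ[ℂ] M where
  map_part : ∀ (i : ZMod 2) (x : L), x ∈ Superspace.part (V := L) i →
    toFun x ∈ Superspace.part (V := M) i
  map_bracket : ∀ x y : L,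
    toFun (LieSuperalgebra.bracket x y) = LieSuperalgebra.bracket (toFun x) (toFun y)

/-- The bilinear extension of `[x, y] = x y - (-1)^{i j} y x`, for `x`, `y` homogeneous of degrees
`i`, `j`, to all elements of a superalgebra. -/
def superCommutator (A : Type*) [Ring A] [Algebra ℂ A] [Superalgebra A] : A →ₗ[ℂ] A →ₗ[ℂ] A :=
  LinearMap.mul ℂ A -
    ∑ i : ZMod 2, ∑ j : ZMod 2, ksign i j • (LinearMap.mul ℂ A).flip.compl₁₂ (proj i) (proj j)

theorem superCommutator_of_mem {A : Type*} [Ring A] [Algebra ℂ A] [Superalgebra A] {i j : ZMod 2}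
    {x y : A} (hx : x ∈ Superspace.part (V := A) i) (hy : y ∈ Superspace.part (V := A) j) :
    superCommutator A x y = x * y - ksign i j • (y * x) := by
  simp only [superCommutator, LinearMap.sub_apply, LinearMap.mul_apply', LinearMap.sum_apply,
    LinearMap.smul_apply, LinearMap.compl₁₂_apply, LinearMap.flip_apply]
  rw [Finset.sum_eq_single i, Finset.sum_eq_single j, proj_of_mem hx, proj_of_mem hy]
  · intro b _ hb
    simp [proj_of_mem_ne hb hy]
  · simp
  · intro b _ hb
    simp [proj_of_mem_ne hb hx]
  · simp

section SuperCommutator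

variable {A : Type*} [Ring A] [Algebra ℂ A] [Superalgebra A] {i j k : ZMod 2} {x y z : A}

theorem superCommutator_mem (hx : x ∈ Superspace.part (V := A) i)
    (hy : y ∈ Superspace.part (V := A) j) :
    superCommutator A x y ∈ Superspace.part (V := A) (i + j) := by
  rw [superCommutator_of_mem hx hy]
  refine sub_mem (Superalgebra.mul_mem hx hy) (Submodule.smul_mem _ _ ?_)
  rw [add_comm]
  exact Superalgebra.mul_mem hy hx

theorem ksign_cases : ksign 0 0 = 1 ∧ ksign 0 1 = 1 ∧ ksign 1 0 = 1 ∧ ksign 1 1 = -1 := by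
  simp [ksign, ZMod.val_one]

theorem superCommutator_skew (hx : x ∈ Superspace.part (V := A) i)
    (hy : y ∈ Superspace.part (V := A) j) :
    superCommutator A x y = -(ksign i j • superCommutator A y x) := by
  have hz : ∀ i : ZMod 2, i = 0 ∨ i = 1 := by decide
  obtain ⟨s₀₀, s₀₁, s₁₀, s₁₁⟩ := ksign_cases
  rw [superCommutator_of_mem hx hy, superCommutator_of_mem hy hx]
  rcases hz i with rfl | rfl <;> rcases hz j with rfl | rfl <;>
    simp only [s₀₀, s₀₁, s₁₀, s₁₁, one_smul, neg_smul] <;> abel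

theorem superCommutator_jacobi (hx : x ∈ Superspace.part (V := A) i)
    (hy : y ∈ Superspace.part (V := A) j) (hz : z ∈ Superspace.part (V := A) k) :
    superCommutator A x (superCommutator A y z) =
      superCommutator A (superCommutator A x y) z +
        ksign i j • superCommutator A y (superCommutator A x z) := by
  have hc : ∀ i : ZMod 2, i = 0 ∨ i = 1 := by decide
  have h₁₁ : (1 : ZMod 2) + 1 = 0 := rfl
  obtain ⟨s₀₀, s₀₁, s₁₀, s₁₁⟩ := ksign_cases
  rw [superCommutator_of_mem hx (superCommutator_mem hy hz),
    superCommutator_of_mem (superCommutator_mem hx hy) hz,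
    superCommutator_of_mem hy (superCommutator_mem hx hz), superCommutator_of_mem hy hz,
    superCommutator_of_mem hx hy, superCommutator_of_mem hx hz]
  rcases hc i with rfl | rfl <;> rcases hc j with rfl | rfl <;> rcases hc k with rfl | rfl <;>
    simp only [s₀₀, s₀₁, s₁₀, s₁₁, one_smul, neg_smul, add_zero, zero_add, h₁₁] <;> noncomm_ring

end SuperCommutator

/-- `Lie(A)`: the superalgebra `A`, considered as a Lie superalgebra. -/
def LieOf (A : Type*) : Type _ := A

namespace LieOf

variable (A : Type*) [Ring A] [Algebra ℂ A] [Superalgebra A]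

instance : AddCommGroup (LieOf A) := inferInstanceAs (AddCommGroup A)

instance : Module ℂ (LieOf A) := inferInstanceAs (Module ℂ A)

variable {A} in
/-- The identity map from `A` to `Lie(A)`. -/
def of : A ≃ₗ[ℂ] LieOf A := LinearEquiv.refl ℂ A

instance : LieSuperalgebra (LieOf A) where
  part := Superspace.part (V := A)
  isCompl := Superspace.isCompl (V := A)
  bracket := superCommutator A
  bracket_mem hx hy := superCommutator_mem (A := A) hx hy
  skew hx hy := superCommutator_skew (A := A) hx hy
  jacobi hx hy hz := superCommutator_jacobi (A := A) hx hy hz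

end LieOf

/-! ### Supermodules -/

/-- `V` is an `A`-supermodule: the action is compatible with the gradings. -/
def IsSupermodule (A V : Type*) [Ring A] [Algebra ℂ A] [Superalgebra A] [AddCommGroup V]
    [Module ℂ V] [Superspace V] [Module A V] [IsScalarTower ℂ A V] : Prop :=
  ∀ (i j : ZMod 2) (a : A) (v : V), a ∈ Superspace.part (V := A) i →
    v ∈ Superspace.part (V := V) j → a • v ∈ Superspace.part (V := V) (i + j)

/-- `V` is a simple `A`-supermodule: it is nonzero and has no graded submodules but `0` and `V`. -/
def IsSimpleSupermodule (A V : Type*) [Ring A] [Algebra ℂ A] [Superalgebra A] [AddCommGroup V]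
    [Module ℂ V] [Superspace V] [Module A V] [IsScalarTower ℂ A V] : Prop :=
  IsSupermodule A V ∧ Nontrivial V ∧
    ∀ U : Submodule A V, (∀ u ∈ U, ∀ i : ZMod 2, proj i u ∈ U) → U = ⊥ ∨ U = ⊤

/-- A simple supermodule of Type M stays simple when the gradings are forgotten. -/
def IsTypeM (A V : Type*) [Ring A] [Algebra ℂ A] [Superalgebra A] [AddCommGroup V]
    [Module ℂ V] [Superspace V] [Module A V] [IsScalarTower ℂ A V] : Prop :=
  IsSimpleSupermodule A V ∧ IsSimpleModule A V

/-- A simple supermodule of Type Q becomes reducible when the gradings are forgotten. -/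
def IsTypeQ (A V : Type*) [Ring A] [Algebra ℂ A] [Superalgebra A] [AddCommGroup V]
    [Module ℂ V] [Superspace V] [Module A V] [IsScalarTower ℂ A V] : Prop :=
  IsSimpleSupermodule A V ∧ ¬ IsSimpleModule A V

/-! ### The group superalgebra of the symmetric group -/

/-- The group algebra `ℂ S_n`. -/
abbrev CS (n : ℕ) : Type := MonoidAlgebra ℂ (Equiv.Perm (Fin n))

/-- The degree of a permutation: `0` if it is even and `1` if it is odd. -/
def permDeg {n : ℕ} (σ : Equiv.Perm (Fin n)) : ZMod 2 := if Equiv.Perm.sign σ = 1 then 0 else 1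

theorem permDeg_mul {n : ℕ} (σ τ : Equiv.Perm (Fin n)) :
    permDeg (σ * τ) = permDeg σ + permDeg τ := by
  rcases Int.units_eq_one_or (Equiv.Perm.sign σ) with h | h <;>
    rcases Int.units_eq_one_or (Equiv.Perm.sign τ) with h' | h' <;>
    simp [permDeg, h, h']
  decide

/-- The elements of degree `i` are the linear combinations of permutations of degree `i`. -/
instance csSuperalgebra (n : ℕ) : Superalgebra (CS n) where
  part i :=
    { carrier := {a | ∀ σ, permDeg σ ≠ i → a.coeff σ = 0}
      add_mem' := fun ha hb σ h => by simp [ha σ h, hb σ h]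
      zero_mem' := fun _ _ => rfl
      smul_mem' := fun z a ha σ h => by simp [ha σ h] }
  isCompl := by
    refine isCompl_of_decomp (fun a h₀ h₁ => ?_) (fun a => ?_)
    · ext σ
      by_cases h : permDeg σ = 0
      · exact h₁ σ (by rw [h]; decide)
      · exact h₀ σ h
    · refine ⟨.ofCoeff (a.coeff.filter fun σ => permDeg σ = 0), fun σ h => ?_,
        .ofCoeff (a.coeff.filter fun σ => ¬ permDeg σ = 0), fun σ h => ?_, ?_⟩
      · exact Finsupp.filter_apply_neg _ _ h
      · exact Finsupp.filter_apply_neg _ _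
          (not_not.2 ((by decide : ∀ x : ZMod 2, x ≠ 1 → x = 0) _ h))
      · exact congrArg MonoidAlgebra.ofCoeff (Finsupp.filter_add_filter_not _ _)
  one_mem := fun σ h => by
    have : σ ≠ 1 := by
      rintro rfl
      exact h (by simp [permDeg])
    simp [MonoidAlgebra.one_def, this.symm]
  mul_mem {i j a b} ha hb := fun σ h => by
    classical
    rw [MonoidAlgebra.coeff_mul]
    refine Finset.sum_eq_zero fun x _ => Finset.sum_eq_zero fun y _ => ?_
    dsimp only
    split_ifs with hxy
    · by_cases hx : permDeg x = i
      · have hy : permDeg y ≠ j := by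
          rintro rfl
          exact h (by rw [← hxy, permDeg_mul, hx])
        rw [hb y hy, mul_zero]
      · rw [ha x hx, zero_mul]
    · rfl

/-! ### Partitions and Specht modules -/

/-- The partitions of `n`, as Young diagrams with `n` boxes; the box `(i, j)` is in row `i` and
column `j`. -/
abbrev Ptn (n : ℕ) : Type := {μ : YoungDiagram // μ.card = n}

/-- The conjugate partition. -/
def Ptn.conj {n : ℕ} (l : Ptn n) : Ptn n :=
  ⟨l.1.transpose, by
    refine Eq.trans ?_ l.2
    simp [YoungDiagram.card, YoungDiagram.transpose]⟩

/-- A tableau of shape `l`: the entry `k` is in the box `t k`. -/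
abbrev Tableau {n : ℕ} (l : Ptn n) : Type := Fin n ≃ {c : ℕ × ℕ // c ∈ l.1.cells}

/-- The sum of the permutations that preserve the rows of the tableau `t`. -/
def rowSum {n : ℕ} {l : Ptn n} (t : Tableau l) : CS n :=
  ∑ σ : Equiv.Perm (Fin n) with ∀ k, (t (σ k)).1.1 = (t k).1.1, MonoidAlgebra.single σ 1

/-- The signed sum of the permutations that preserve the columns of the tableau `t`. -/
def colSum {n : ℕ} {l : Ptn n} (t : Tableau l) : CS n :=
  ∑ σ : Equiv.Perm (Fin n) with ∀ k, (t (σ k)).1.2 = (t k).1.2,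
    MonoidAlgebra.single σ ((Equiv.Perm.sign σ : ℤ) : ℂ)

/-- The Specht module of shape `l`, realized as the left ideal of `ℂ S_n` generated by the Young
symmetrizer of a tableau `t` of shape `l`. (The left ideal generated by `rowSum t` is the
permutation module on tabloids of shape `l`, and `colSum t * rowSum t` is the polytabloid of `t`.) -/
def Specht {n : ℕ} {l : Ptn n} (t : Tableau l) : Submodule (CS n) (CS n) :=
  Submodule.span (CS n) {colSum t * rowSum t}

/-- `f^l`, the dimension of the Specht module of shape `l`. -/
def spechtDim {n : ℕ} (T : ∀ l : Ptn n, Tableau l) (l : Ptn n) : ℕ :=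
  Module.finrank ℂ (Specht (T l))

/-- A choice of linear isomorphisms `φ^l : S^l → S^{l'}` with `φ^l (σ v) = (-1)^σ σ φ^l(v)` and such
that `φ^{l'}` and `φ^l` are mutually inverse. (All Specht modules are submodules of `ℂ S_n`, which
makes `S^{l''}` equal to `S^l`.) -/
structure Associator {n : ℕ} (T : ∀ l : Ptn n, Tableau l) where
  toFun : ∀ l : Ptn n, Specht (T l) →ₗ[ℂ] Specht (T l.conj)
  intertwines : ∀ (l : Ptn n) (σ : Equiv.Perm (Fin n)) (v : Specht (T l)),
    toFun l ((MonoidAlgebra.single σ 1 : CS n) • v) =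
      ((Equiv.Perm.sign σ : ℤ) : ℂ) • (MonoidAlgebra.single σ 1 : CS n) • toFun l v
  inverse : ∀ (l : Ptn n) (v : Specht (T l)), (toFun l.conj (toFun l v) : CS n) = v

/-! ### The supermodules `W^l` -/

section W

variable {n : ℕ} {T : ∀ l : Ptn n, Tableau l}

theorem specht_congr {l m : Ptn n} (h : m = l) : Specht (T m) = Specht (T l) := by
  subst h
  rfl

theorem Associator.congr (φ : Associator T) {l m : Ptn n} (h : m = l) (w : Specht (T m))
    (u : Specht (T l)) (hu : (w : CS n) = u) : (φ.toFun m w : CS n) = φ.toFun l u := by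
  subst h
  rw [Subtype.ext hu]

theorem Associator.injective (φ : Associator T) {l : Ptn n} {u : Specht (T l)}
    (hu : φ.toFun l u = 0) : u = 0 := by
  have h := φ.inverse l u
  rw [hu, map_zero, Submodule.coe_zero] at h
  exact Subtype.ext (h.symm.trans Submodule.coe_zero.symm)

theorem Associator.surjective (φ : Associator T) (l : Ptn n) (v : Specht (T l.conj)) :
    ∃ u : Specht (T l), φ.toFun l u = v := by
  have h : l.conj.conj = l := Subtype.ext (YoungDiagram.transpose_transpose _)
  obtain ⟨x, hx⟩ : ∃ x : Specht (T l), (φ.toFun l.conj v : CS n) = x :=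
    ⟨⟨φ.toFun l.conj v, (specht_congr (T := T) h).le (Subtype.mem _)⟩, rfl⟩
  refine ⟨x, Subtype.ext ?_⟩
  rw [← φ.congr h _ x hx]
  exact φ.inverse l.conj v

theorem Associator.exists_eq (φ : Associator T) {l : Ptn n} (h : l.conj = l) (u : Specht (T l)) :
    ∃ x : Specht (T l), (φ.toFun l u : CS n) = x ∧ (φ.toFun l x : CS n) = u := by
  obtain ⟨x, hx⟩ : ∃ x : Specht (T l), (φ.toFun l u : CS n) = x :=
    ⟨⟨φ.toFun l u, (specht_congr (T := T) h).le (Subtype.mem _)⟩, rfl⟩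
  refine ⟨x, hx, ?_⟩
  rw [← φ.congr h _ x hx]
  exact φ.inverse l u

variable (φ : Associator T) (l : Ptn n)

/-- The subspaces `{u + φ(u) : u ∈ S^l}` (for `i = 0`) and `{u - φ(u) : u ∈ S^l}` (for `i = 1`) of
`S^l ⊕ S^{l'}`. -/
def wePart (i : ZMod 2) : Submodule ℂ (Specht (T l) × Specht (T l.conj)) :=
  LinearMap.range (LinearMap.prod LinearMap.id (ksign i 1 • φ.toFun l))

theorem mem_wePart (i : ZMod 2) (w : Specht (T l) × Specht (T l.conj)) :
    w ∈ wePart φ l i ↔ w.2 = ksign i 1 • φ.toFun l w.1 := by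
  constructor
  · rintro ⟨u, rfl⟩
    rfl
  · intro h
    exact ⟨w.1, Prod.ext rfl h.symm⟩

theorem isCompl_wePart : IsCompl (wePart φ l 0) (wePart φ l 1) := by
  obtain ⟨-, s₀, -, s₁⟩ := ksign_cases
  refine isCompl_of_decomp (fun w h₀ h₁ => ?_) (fun w => ?_)
  · rw [mem_wePart] at h₀ h₁
    rw [s₀, one_smul] at h₀
    rw [s₁, neg_one_smul ℂ (φ.toFun l w.1), h₀] at h₁
    have h₂ : (2 : ℂ) • φ.toFun l w.1 = 0 := by
      rw [two_smul]
      nth_rewrite 1 [h₁]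
      exact neg_add_cancel _
    have h₃ : φ.toFun l w.1 = 0 := (smul_eq_zero_iff_right two_ne_zero).1 h₂
    exact Prod.ext (φ.injective h₃) (h₀.trans h₃)
  · obtain ⟨x, hx⟩ := φ.surjective l w.2
    refine ⟨((2⁻¹ : ℂ) • (w.1 + x), (2⁻¹ : ℂ) • φ.toFun l (w.1 + x)), ?_,
      ((2⁻¹ : ℂ) • (w.1 - x), -((2⁻¹ : ℂ) • φ.toFun l (w.1 - x))), ?_, Prod.ext ?_ ?_⟩
    · rw [mem_wePart, s₀, one_smul]
      exact (map_smul _ _ _).symm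
    · rw [mem_wePart, s₁]
      refine Eq.trans ?_ (neg_one_smul ℂ (φ.toFun l ((2⁻¹ : ℂ) • (w.1 - x)))).symm
      exact congrArg Neg.neg (map_smul _ _ _).symm
    · change (2⁻¹ : ℂ) • (w.1 + x) + (2⁻¹ : ℂ) • (w.1 - x) = w.1
      module
    · change (2⁻¹ : ℂ) • φ.toFun l (w.1 + x) + -((2⁻¹ : ℂ) • φ.toFun l (w.1 - x)) = w.2
      rw [map_add, map_sub, hx]
      module

/-- The map `J` on `S^l ⊕ S^{l'}` with `J(u ± φ(u)) = u ∓ φ(u)` for `u ∈ S^l`: the identity on `S^l`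
and minus the identity on `S^{l'}`. -/
def weJ : Module.End ℂ (Specht (T l) × Specht (T l.conj)) :=
  LinearMap.prodMap LinearMap.id (-LinearMap.id)

theorem weJ_mem (j : ZMod 2) (w : Specht (T l) × Specht (T l.conj)) (hw : w ∈ wePart φ l j) :
    weJ (T := T) l w ∈ wePart φ l (1 + j) := by
  obtain ⟨-, s₀, -, s₁⟩ := ksign_cases
  rw [mem_wePart] at hw ⊢
  change -w.2 = ksign (1 + j) 1 • φ.toFun l w.1
  have hs : ksign (1 + j) 1 = -ksign j 1 := by
    rcases (by decide : ∀ i : ZMod 2, i = 0 ∨ i = 1) j with rfl | rfl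
    · rw [add_zero, s₀, s₁]
    · rw [show (1 : ZMod 2) + 1 = 0 from rfl, s₀, s₁, neg_neg]
  rw [hs, hw]
  exact (neg_smul (ksign j 1) (φ.toFun l w.1)).symm

/-- The eigenspaces of `φ^l : S^l → S^l`, where `l = l'`, for the eigenvalues `1` (for `i = 0`) and
`-1` (for `i = 1`). -/
def wfPart (i : ZMod 2) : Submodule ℂ (Specht (T l)) where
  carrier := {u | (φ.toFun l u : CS n) = ksign i 1 • (u : CS n)}
  add_mem' {u v} hu hv := by
    simp only [Set.mem_ofPred_eq] at hu hv ⊢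
    rw [map_add, Submodule.coe_add, Submodule.coe_add, hu, hv, smul_add]
  zero_mem' := by
    simp only [Set.mem_ofPred_eq]
    rw [map_zero, Submodule.coe_zero, Submodule.coe_zero, smul_zero]
  smul_mem' c u hu := by
    simp only [Set.mem_ofPred_eq] at hu ⊢
    rw [map_smul, Submodule.coe_smul_of_tower, Submodule.coe_smul_of_tower, hu, smul_comm]

theorem isCompl_wfPart (h : l.conj = l) : IsCompl (wfPart φ l 0) (wfPart φ l 1) := by
  obtain ⟨-, s₀, -, s₁⟩ := ksign_cases
  have mem (i : ZMod 2) (u : Specht (T l)) :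
    u ∈ wfPart φ l i ↔ (φ.toFun l u : CS n) = ksign i 1 • (u : CS n) := Iff.rfl
  refine isCompl_of_decomp (fun u h₀ h₁ => ?_) (fun u => ?_)
  · rw [mem] at h₀ h₁
    rw [s₀, one_smul] at h₀
    rw [s₁, neg_one_smul, h₀] at h₁
    have h₂ : (2 : ℂ) • (u : CS n) = 0 := by
      rw [two_smul]
      nth_rewrite 1 [h₁]
      exact neg_add_cancel _
    exact Subtype.ext ((smul_eq_zero_iff_right two_ne_zero).1 h₂)
  · obtain ⟨x, hx, hx'⟩ := φ.exists_eq h u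
    refine ⟨(2⁻¹ : ℂ) • (u + x), ?_, (2⁻¹ : ℂ) • (u - x), ?_, by module⟩
    · rw [mem, map_smul, map_add, Submodule.coe_smul_of_tower, Submodule.coe_smul_of_tower,
        Submodule.coe_add, Submodule.coe_add, hx, hx', s₀]
      module
    · rw [mem, map_smul, map_sub, Submodule.coe_smul_of_tower, Submodule.coe_smul_of_tower,
        Submodule.coe_sub, Submodule.coe_sub, hx, hx', s₁]
      module

/-- For `l ≠ l'`: the supermodule `W^l = S^l ⊕ S^{l'}`. -/
def WE (_φ : Associator T) (l : Ptn n) : Type := Specht (T l) × Specht (T l.conj)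

instance : AddCommGroup (WE φ l) := inferInstanceAs (AddCommGroup (Specht (T l) × Specht (T l.conj)))

instance : Module ℂ (WE φ l) := inferInstanceAs (Module ℂ (Specht (T l) × Specht (T l.conj)))

instance : Module (CS n) (WE φ l) :=
  inferInstanceAs (Module (CS n) (Specht (T l) × Specht (T l.conj)))

instance : IsScalarTower ℂ (CS n) (WE φ l) :=
  inferInstanceAs (IsScalarTower ℂ (CS n) (Specht (T l) × Specht (T l.conj)))

instance weSuperspace : Superspace (WE φ l) where
  part := wePart φ l
  isCompl := isCompl_wePart φ l

/-- The odd involution `J^l` of `W^l`, for `l ≠ l'`. -/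
def weInvolution : OddInvolution (WE φ l) where
  toEnd := weJ (T := T) l
  odd := weJ_mem φ l
  sq := LinearMap.ext fun w => Prod.ext rfl (neg_neg w.2)

/-- For `l = l'`: the supermodule `W^l = S^l`. -/
def WF (_φ : Associator T) (l : Ptn n) (_h : l.conj = l) : Type := Specht (T l)

variable (h : l.conj = l)

instance : AddCommGroup (WF φ l h) := inferInstanceAs (AddCommGroup (Specht (T l)))

instance : Module ℂ (WF φ l h) := inferInstanceAs (Module ℂ (Specht (T l)))

instance : Module (CS n) (WF φ l h) := inferInstanceAs (Module (CS n) (Specht (T l)))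

instance : IsScalarTower ℂ (CS n) (WF φ l h) :=
  inferInstanceAs (IsScalarTower ℂ (CS n) (Specht (T l)))

instance wfSuperspace : Superspace (WF φ l h) where
  part := wfPart φ l
  isCompl := isCompl_wfPart φ l h

end W

/-! ### Representatives of partitions up to conjugation -/

/-- `P` is a set of representatives for the classes `{l, l'}` of partitions of `n`. -/
def IsConjReps {n : ℕ} (P : Set (Ptn n)) : Prop :=
  ∀ l : Ptn n, ∃! m : Ptn n, m ∈ P ∧ (m = l ∨ m = l.conj)

/-- `E_n`: the representatives `l` with `l ≠ l'`. -/
abbrev EReps {n : ℕ} (P : Set (Ptn n)) : Type := {l : Ptn n // l ∈ P ∧ l.conj ≠ l}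

/-- `F_n`: the representatives `l` with `l = l'`. -/
abbrev FReps {n : ℕ} (P : Set (Ptn n)) : Type := {l : Ptn n // l ∈ P ∧ l.conj = l}

section Targets

variable {n : ℕ} {T : ∀ l : Ptn n, Tableau l}

/-- `Q(W^l) = Q(W^l, J^l)` for `l ∈ E_n`. -/
abbrev QW (φ : Associator T) {P : Set (Ptn n)} (l : EReps P) :
    Subalgebra ℂ (Module.End ℂ (WE φ l.1)) :=
  QEnd (weInvolution φ l.1)

/-- `End(W^l)` for `l ∈ F_n`. -/
abbrev EndW (φ : Associator T) {P : Set (Ptn n)} (l : FReps P) : Type :=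
  Module.End ℂ (WF φ l.1 l.2.2)

end Targets

end SymSuper
end

open SymSuper

/-! Without gradings, this is the Wedderburn decomposition of `ℂS_n`, with the factors of `λ` and
`λ'` grouped together. Three facts carry the proof.

First, `ℂS_n` is the product of the algebras `End(S^λ)`. Write `C_t`, `R_s` for column and row sums
of tableaux. If some pair of entries lies in one column of `t` and in one row of `g s`, its
transposition is absorbed with sign -1 on the left and +1 on the right, so `C_t g R_s = 0`. If there
is no such pair, counting entries column by column shows that the shape of `t` dominates that of
`s`; when the shapes agree, `g` is a column permutation of `t` times a row permutation. Hence `C_t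
ℂS_n R_s` vanishes unless the shape of `t` dominates that of `s` (`colSum_mul_mul_rowSum_eq_zero`),
and `C_t ℂS_n R_t` is a line (`exists_colSum_mul_mul_rowSum`). With semisimplicity this makes the
Specht modules simple and pairwise non-isomorphic. Schur's lemma and Jacobson density then give
surjectivity onto `∏ End(S^λ)` (`exists_smul_eq`). Injectivity follows because the centre has
dimension at most the number of partitions (`eq_zero_of_smul_eq_zero`).

Second, the automorphism `σ ↦ sgn(σ) σ` exchanges row sums of `t` with column sums of the transpose
of `t`, which produces twisted isomorphisms `S^λ → S^{λ'}` (`exists_isTwisted`). For `λ = λ'` the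
square of such a map is a scalar by Schur's lemma, and dividing by a square root of that scalar
makes the map an involution (`nonempty_associator`).

Third, a twisted map commutes with an element of degree `i` up to `(-1)^i`, so the action on each
`W^λ` respects the gradings. As `J^λ` is 1 on `S^λ` and -1 on `S^{λ'}`, its centralizer is `End(S^λ)
× End(S^{λ'})`. Each shape is thus counted exactly once in the target, and bijectivity reduces to
the first fact. The matrix forms come from homogeneous bases, chosen compatibly with `J^λ` in Type
Q; a transposition acts as an odd involution, so even and odd parts have equal dimension. The Lie
statement is formal, since the super commutator depends only on product and grading. -/

noncomputable section

namespace SymSuper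

/-! ### Combinatorics of tableaux -/

section Combinatorics

variable {n : ℕ}

/-- The number of boxes in the first `i` rows of column `j`. -/
def colHead (μ : YoungDiagram) (i j : ℕ) : ℕ := min i (μ.colLen j)

theorem card_filter_box {l : Ptn n} (t : Tableau l) (p : ℕ × ℕ → Prop) [DecidablePred p] :
    (Finset.univ.filter fun k => p (t k).1).card = (l.1.cells.filter p).card := by
  refine Finset.card_bij (fun k _ => (t k).1) ?_ ?_ ?_
  · intro k hk
    simpa [(t k).2] using hk
  · intro a _ b _ h
    exact t.injective (Subtype.ext h)
  · intro c hc
    rw [Finset.mem_filter] at hc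
    exact ⟨t.symm ⟨c, hc.1⟩, by simpa using hc.2, by simp⟩

theorem card_filter_cells (μ : YoungDiagram) (i j : ℕ) :
    (μ.cells.filter fun c => c.1 < i ∧ c.2 = j).card = colHead μ i j := by
  have h : (μ.cells.filter fun c => c.1 < i ∧ c.2 = j) =
      (Finset.range (colHead μ i j)).image fun r => (r, j) := by
    ext ⟨a, b⟩
    simp only [Finset.mem_filter, YoungDiagram.mem_cells, YoungDiagram.mem_iff_lt_colLen,
      Finset.mem_image, Finset.mem_range, colHead, lt_min_iff, Prod.mk.injEq]
    constructor
    · rintro ⟨h₁, h₂, rfl⟩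
      exact ⟨a, ⟨h₂, h₁⟩, rfl, rfl⟩
    · rintro ⟨r, ⟨h₂, h₁⟩, rfl, rfl⟩
      exact ⟨h₁, h₂, rfl⟩
  rw [h, Finset.card_image_of_injective _ (fun a b h => (Prod.mk.inj h).1), Finset.card_range]

theorem snd_lt_of_mem {l : Ptn n} {c : ℕ × ℕ} (hc : c ∈ l.1.cells) : c.2 < n := by
  have h : (Finset.range (c.2 + 1)).image (fun j => (c.1, j)) ⊆ l.1.cells := by
    intro d hd
    obtain ⟨j, hj, rfl⟩ := Finset.mem_image.1 hd
    exact l.1.up_left_mem le_rfl (Nat.lt_succ_iff.1 (Finset.mem_range.1 hj)) hc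
  have := Finset.card_le_card h
  rw [Finset.card_image_of_injective _ (fun a b h => (Prod.mk.inj h).2), Finset.card_range] at this
  have hcard := l.2
  rw [YoungDiagram.card] at hcard
  omega

/-- The number of boxes in the first `i` rows. -/
def rowsHead (l : Ptn n) (i : ℕ) : ℕ := (l.1.cells.filter fun c => c.1 < i).card

theorem rowsHead_eq_sum (l : Ptn n) (i : ℕ) :
    rowsHead l i = ∑ j ∈ Finset.range n, colHead l.1 i j := by
  rw [rowsHead, Finset.card_eq_sum_card_fiberwise (f := Prod.snd) (t := Finset.range n)]
  · refine Finset.sum_congr rfl fun j _ => ?_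
    rw [Finset.filter_filter, card_filter_cells]
  · intro c hc
    simp only [Finset.coe_filter, Set.mem_ofPred_eq] at hc
    exact Finset.mem_coe.2 (Finset.mem_range.2 (snd_lt_of_mem hc.1))

theorem rowsHead_succ (l : Ptn n) (i : ℕ) : rowsHead l (i + 1) = rowsHead l i + l.1.rowLen i := by
  rw [rowsHead, rowsHead, YoungDiagram.rowLen_eq_card, YoungDiagram.row,
    ← Finset.card_union_of_disjoint]
  · congr 1
    ext c
    simp only [Finset.mem_filter, Finset.mem_union, Nat.lt_succ_iff_lt_or_eq]
    tauto
  · refine Finset.disjoint_filter.2 fun c _ h h' => ?_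
    omega

theorem eq_of_rowsHead_eq {l m : Ptn n} (h : ∀ i, rowsHead l i = rowsHead m i) : l = m := by
  have hr (i : ℕ) : l.1.rowLen i = m.1.rowLen i := by
    have := h (i + 1)
    rw [rowsHead_succ, rowsHead_succ, h i] at this
    omega
  refine Subtype.ext (YoungDiagram.ext ?_)
  ext ⟨i, j⟩
  rw [YoungDiagram.mem_cells, YoungDiagram.mem_cells, YoungDiagram.mem_iff_lt_rowLen,
    YoungDiagram.mem_iff_lt_rowLen, hr]

variable {l m : Ptn n} {t : Tableau l} {s : Tableau m}

/-- No two entries are in the same row of `s` and in the same column of `t`. -/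
def Separated (t : Tableau l) (s : Tableau m) : Prop :=
  ∀ i j : Fin n, (s i).1.1 = (s j).1.1 → (t i).1.2 = (t j).1.2 → i = j

/-- By separation, the entries of one column of `t` lie in distinct rows of `s`, so at most `i` of
them are in the first `i` rows; and there are no more of them than the column has boxes. -/
theorem Separated.card_le (h : Separated t s) (i j : ℕ) :
    (Finset.univ.filter fun k => (s k).1.1 < i ∧ (t k).1.2 = j).card ≤ colHead l.1 i j := by
  refine le_min ?_ ?_
  · conv_rhs => rw [← Finset.card_range i]
    refine Finset.card_le_card_of_injOn (fun k => (s k).1.1) ?_ ?_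
    · intro k hk
      simp only [Finset.coe_filter, Set.mem_ofPred_eq] at hk
      exact Finset.mem_coe.2 (Finset.mem_range.2 hk.2.1)
    · intro a ha b hb hab
      simp only [Finset.coe_filter, Set.mem_ofPred_eq] at ha hb
      exact h a b hab (ha.2.2.trans hb.2.2.symm)
  · rw [YoungDiagram.colLen_eq_card, YoungDiagram.col, ← card_filter_box t]
    exact Finset.card_le_card (Finset.monotone_filter_right _ fun k _ hk => hk.2)

theorem rowsHead_eq_sum_separated (t : Tableau l) (s : Tableau m) (i : ℕ) :
    rowsHead m i = ∑ j ∈ Finset.range n,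
      (Finset.univ.filter fun k => (s k).1.1 < i ∧ (t k).1.2 = j).card := by
  rw [rowsHead, ← card_filter_box s, Finset.card_eq_sum_card_fiberwise
    (f := fun k => (t k).1.2) (t := Finset.range n)]
  · refine Finset.sum_congr rfl fun j _ => ?_
    rw [Finset.filter_filter]
  · intro k _
    exact Finset.mem_coe.2 (Finset.mem_range.2 (snd_lt_of_mem (t k).2))

theorem Separated.rowsHead_le (h : Separated t s) (i : ℕ) : rowsHead m i ≤ rowsHead l i := by
  rw [rowsHead_eq_sum_separated t s, rowsHead_eq_sum]
  exact Finset.sum_le_sum fun j _ => h.card_le i j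

/-- When the shapes agree, both sides of `Separated.card_le` have the same sum over the columns, so
each of these inequalities is an equality. The entry `k` makes the count grow from row bound `i` to
`i + 1`, where `i` is its row in `s`; thus `min i c < min (i + 1) c` for the length `c` of its
column in `t`, which forces `i < c`. -/
theorem Separated.mem_cells {s : Tableau l} (h : Separated t s) (k : Fin n) :
    ((s k).1.1, (t k).1.2) ∈ l.1.cells := by
  have key (i j : ℕ) (hj : j < n) :
      (Finset.univ.filter fun k => (s k).1.1 < i ∧ (t k).1.2 = j).card = colHead l.1 i j := by
    have e := (rowsHead_eq_sum_separated t s i).symm.trans (rowsHead_eq_sum l i)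
    exact (Finset.sum_eq_sum_iff_of_le fun j _ => h.card_le i j).1 e j (Finset.mem_range.2 hj)
  have hj := snd_lt_of_mem (t k).2
  have hlt : (Finset.univ.filter fun k' => (s k').1.1 < (s k).1.1 ∧ (t k').1.2 = (t k).1.2).card <
      (Finset.univ.filter fun k' => (s k').1.1 < (s k).1.1 + 1 ∧ (t k').1.2 = (t k).1.2).card := by
    refine Finset.card_lt_card ⟨Finset.monotone_filter_right _
      fun k' _ hk => ⟨hk.1.trans (Nat.lt_succ_self _), hk.2⟩, fun hsub => ?_⟩
    have := hsub (Finset.mem_filter.2 ⟨Finset.mem_univ k, Nat.lt_succ_self _, rfl⟩)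
    exact lt_irrefl _ (Finset.mem_filter.1 this).2.1
  rw [key _ _ hj, key _ _ hj, colHead, colHead] at hlt
  rw [YoungDiagram.mem_cells, YoungDiagram.mem_iff_lt_colLen]
  omega

/-- Two tableaux of the same shape without a pair of entries in a row of the one and a column of
the other are related by a column permutation of the one and a row permutation of the other. -/
theorem Separated.exists_perm {s : Tableau l} (h : Separated t s) :
    ∃ q p : Equiv.Perm (Fin n), (∀ k, (t (q k)).1.2 = (t k).1.2) ∧
      (∀ k, (s (p k)).1.1 = (s k).1.1) ∧ ∀ k, t (q k) = s (p k) := by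
  -- The box in the row of `k` in `s` and the column of `k` in `t`. Separation makes `u` injective;
  -- `q` and `p` send `k` to the entry of `t`, respectively of `s`, in this box.
  let u : Fin n → {c : ℕ × ℕ // c ∈ l.1.cells} := fun k => ⟨_, h.mem_cells k⟩
  have hu : Function.Injective u := fun i j hij =>
    h i j (congrArg (fun c => c.1.1) hij) (congrArg (fun c => c.1.2) hij)
  have hq : Function.Injective fun k => t.symm (u k) := t.symm.injective.comp hu
  have hp : Function.Injective fun k => s.symm (u k) := s.symm.injective.comp hu
  refine ⟨Equiv.ofBijective _ (Finite.injective_iff_bijective.1 hq),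
    Equiv.ofBijective _ (Finite.injective_iff_bijective.1 hp), ?_, ?_, ?_⟩ <;> intro k <;> simp [u]

end Combinatorics

/-! ### Counting partitions -/

theorem card_eq_sum_rowLens (μ : YoungDiagram) : μ.card = μ.rowLens.sum := by
  rw [YoungDiagram.rowLens, YoungDiagram.card,
    Finset.card_eq_sum_card_fiberwise (f := Prod.fst) (t := Finset.range (μ.colLen 0))]
  · change _ = ∑ i ∈ Finset.range (μ.colLen 0), μ.rowLen i
    refine Finset.sum_congr rfl fun i _ => ?_
    rw [YoungDiagram.rowLen_eq_card, YoungDiagram.row]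
  · rintro ⟨i, j⟩ hc
    refine Finset.mem_coe.2 (Finset.mem_range.2 ?_)
    rw [← YoungDiagram.mem_iff_lt_colLen]
    exact μ.up_left_mem le_rfl (Nat.zero_le j) hc

/-- Young diagrams with `n` boxes are partitions of `n`. -/
def ptnEquiv (n : ℕ) : Ptn n ≃ n.Partition where
  toFun l := ⟨l.1.rowLens, fun h => l.1.pos_of_mem_rowLens _ h, by
    rw [Multiset.sum_coe, ← card_eq_sum_rowLens, l.2]⟩
  invFun p := ⟨YoungDiagram.ofRowLens (p.parts.sort (· ≥ ·)) (Multiset.pairwise_sort _ _).sortedGE, by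
    rw [card_eq_sum_rowLens, YoungDiagram.rowLens_ofRowLens_eq_self, ← Multiset.sum_coe,
      Multiset.sort_eq, p.parts_sum]
    intro x hx
    exact p.parts_pos ((Multiset.mem_sort _).1 hx)⟩
  left_inv l := by
    refine Subtype.ext ?_
    have : Multiset.sort (l.1.rowLens : Multiset ℕ) (· ≥ ·) = l.1.rowLens :=
      ((Multiset.coe_eq_coe.1 (Multiset.sort_eq _ _)).eq_of_pairwise
        (fun a b _ _ h h' => le_antisymm h' h) (Multiset.pairwise_sort _ _)
        l.1.rowLens_sorted.pairwise)
    simp only [this]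
    exact YoungDiagram.ofRowLens_to_rowLens_eq_self
  right_inv p := by
    refine Nat.Partition.ext ?_
    simp only
    rw [YoungDiagram.rowLens_ofRowLens_eq_self, Multiset.sort_eq]
    intro x hx
    exact p.parts_pos ((Multiset.mem_sort _).1 hx)

instance (n : ℕ) : Finite (Ptn n) := Finite.of_equiv _ (ptnEquiv n).symm

/-- Permutations with the same cycle type are conjugate. -/
theorem card_conjClasses_le (n : ℕ) :
    Nat.card (ConjClasses (Equiv.Perm (Fin n))) ≤ Nat.card (Ptn n) := by
  rw [Nat.card_congr (ptnEquiv n)]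
  have h : Nat.card n.Partition = Nat.card (Fintype.card (Fin n)).Partition := by
    rw [Fintype.card_fin]
  rw [h]
  refine Nat.card_le_card_of_injective
    (fun c => Quotient.liftOn c Equiv.Perm.partition
      fun σ τ hh => Equiv.Perm.partition_eq_of_isConj.1 hh) ?_
  rintro ⟨σ⟩ ⟨τ⟩ hh
  exact Quotient.sound (Equiv.Perm.partition_eq_of_isConj.2 hh)

/-! ### Young symmetrizers -/

open MonoidAlgebra (single)

section Symmetrizer

variable {n : ℕ} {l m : Ptn n}

theorem coeff_rowSum (t : Tableau l) (σ : Equiv.Perm (Fin n)) :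
    (rowSum t).coeff σ = if ∀ k, (t (σ k)).1.1 = (t k).1.1 then 1 else 0 := by
  classical
  rw [rowSum, MonoidAlgebra.coeff_sum, Finsupp.finsetSum_apply]
  simp only [MonoidAlgebra.coeff_single, Finsupp.single_apply]
  rw [Finset.sum_ite_eq']
  simp

theorem coeff_colSum (t : Tableau l) (σ : Equiv.Perm (Fin n)) :
    (colSum t).coeff σ =
      if ∀ k, (t (σ k)).1.2 = (t k).1.2 then ((Equiv.Perm.sign σ : ℤ) : ℂ) else 0 := by
  classical
  rw [colSum, MonoidAlgebra.coeff_sum, Finsupp.finsetSum_apply]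
  simp only [MonoidAlgebra.coeff_single, Finsupp.single_apply]
  rw [Finset.sum_ite_eq']
  simp

theorem coeff_mul_apply_sum (x y : CS n) (σ : Equiv.Perm (Fin n)) :
    (x * y).coeff σ = ∑ τ, x.coeff τ * y.coeff (τ⁻¹ * σ) := by
  rw [MonoidAlgebra.coeff_mul_apply_left, Finsupp.sum_fintype]
  simp

/-- The coefficient at the identity is a trace form; it serves to show that products of row and
column sums are nonzero. -/
theorem coeff_one_mul_comm (x y : CS n) : (x * y).coeff 1 = (y * x).coeff 1 := by
  rw [coeff_mul_apply_sum, coeff_mul_apply_sum, ← Equiv.sum_comp (Equiv.inv _)]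
  refine Finset.sum_congr rfl fun τ _ => ?_
  simp [mul_comm]

theorem coeff_single_mul' (σ τ : Equiv.Perm (Fin n)) (x : CS n) :
    (single σ 1 * x).coeff τ = x.coeff (σ⁻¹ * τ) := by
  rw [MonoidAlgebra.coeff_single_mul_apply, one_mul]

theorem coeff_mul_single' (σ τ : Equiv.Perm (Fin n)) (x : CS n) :
    (x * single σ 1).coeff τ = x.coeff (τ * σ⁻¹) := by
  rw [MonoidAlgebra.coeff_mul_single_apply, mul_one]

theorem single_eq_smul (σ : Equiv.Perm (Fin n)) (r : ℂ) :
    (single σ r : CS n) = r • single σ 1 := by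
  rw [MonoidAlgebra.smul_single, smul_eq_mul, mul_one]

theorem perm_apply_inv (σ : Equiv.Perm (Fin n)) (k : Fin n) : σ (σ⁻¹ k) = k :=
  Equiv.apply_symm_apply σ k

theorem perm_inv_apply (σ : Equiv.Perm (Fin n)) (k : Fin n) : σ⁻¹ (σ k) = k :=
  Equiv.symm_apply_apply σ k

theorem sign_mul_self (σ : Equiv.Perm (Fin n)) :
    ((Equiv.Perm.sign σ : ℤ) : ℂ) * ((Equiv.Perm.sign σ : ℤ) : ℂ) = 1 := by
  rcases Int.units_eq_one_or (Equiv.Perm.sign σ) with h | h <;> simp [h]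

variable {t : Tableau l}

theorem single_mul_rowSum {p : Equiv.Perm (Fin n)} (hp : ∀ k, (t (p k)).1.1 = (t k).1.1) :
    single p 1 * rowSum t = rowSum t := by
  ext σ
  rw [coeff_single_mul', coeff_rowSum, coeff_rowSum]
  congr 1
  refine propext (forall_congr' fun k => ?_)
  rw [← hp, Equiv.Perm.mul_apply, perm_apply_inv]

theorem single_mul_colSum {q : Equiv.Perm (Fin n)} (hq : ∀ k, (t (q k)).1.2 = (t k).1.2) :
    single q 1 * colSum t = ((Equiv.Perm.sign q : ℤ) : ℂ) • colSum t := by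
  ext σ
  rw [coeff_single_mul', MonoidAlgebra.coeff_smul_apply, coeff_colSum, coeff_colSum]
  have : (∀ k, (t ((q⁻¹ * σ) k)).1.2 = (t k).1.2) ↔ ∀ k, (t (σ k)).1.2 = (t k).1.2 := by
    refine forall_congr' fun k => ?_
    rw [← hq, Equiv.Perm.mul_apply, perm_apply_inv]
  simp only [this]
  split_ifs <;> simp

theorem colSum_mul_single {q : Equiv.Perm (Fin n)} (hq : ∀ k, (t (q k)).1.2 = (t k).1.2) :
    colSum t * single q 1 = ((Equiv.Perm.sign q : ℤ) : ℂ) • colSum t := by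
  ext σ
  rw [coeff_mul_single', MonoidAlgebra.coeff_smul_apply, coeff_colSum, coeff_colSum]
  have : (∀ k, (t ((σ * q⁻¹) k)).1.2 = (t k).1.2) ↔ ∀ k, (t (σ k)).1.2 = (t k).1.2 := by
    refine ⟨fun h k => ?_, fun h k => ?_⟩
    · have := h (q k)
      rwa [Equiv.Perm.mul_apply, perm_inv_apply, hq] at this
    · rw [Equiv.Perm.mul_apply, h, ← hq, perm_apply_inv]
  simp only [this]
  split_ifs <;> simp [mul_comm]

theorem exists_rowSum_mul_rowSum (t : Tableau l) :
    ∃ r : ℂ, r ≠ 0 ∧ rowSum t * rowSum t = r • rowSum t := by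
  refine ⟨((Finset.univ.filter fun σ : Equiv.Perm (Fin n) =>
    ∀ k, (t (σ k)).1.1 = (t k).1.1).card : ℂ), ?_, ?_⟩
  · exact Nat.cast_ne_zero.2 (Finset.card_ne_zero.2 ⟨1, by simp⟩)
  · nth_rewrite 1 [rowSum]
    rw [Finset.sum_mul, Finset.sum_congr rfl fun σ hσ =>
      single_mul_rowSum (Finset.mem_filter.1 hσ).2, Finset.sum_const, Nat.cast_smul_eq_nsmul]

theorem exists_colSum_mul_colSum (t : Tableau l) :
    ∃ r : ℂ, r ≠ 0 ∧ colSum t * colSum t = r • colSum t := by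
  refine ⟨((Finset.univ.filter fun σ : Equiv.Perm (Fin n) =>
    ∀ k, (t (σ k)).1.2 = (t k).1.2).card : ℂ), ?_, ?_⟩
  · exact Nat.cast_ne_zero.2 (Finset.card_ne_zero.2 ⟨1, by simp⟩)
  · have key : ∀ σ ∈ Finset.univ.filter fun σ : Equiv.Perm (Fin n) =>
        ∀ k, (t (σ k)).1.2 = (t k).1.2,
        single σ ((Equiv.Perm.sign σ : ℤ) : ℂ) * colSum t = colSum t := by
      intro σ hσ
      rw [single_eq_smul, smul_mul_assoc, single_mul_colSum (Finset.mem_filter.1 hσ).2, smul_smul, sign_mul_self,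
        one_smul]
    nth_rewrite 1 [colSum]
    rw [Finset.sum_mul, Finset.sum_congr rfl key, Finset.sum_const, Nat.cast_smul_eq_nsmul]

/-- Only the identity preserves both the rows and the columns of `t`. -/
theorem coeff_one_colSum_mul_rowSum (t : Tableau l) : (colSum t * rowSum t).coeff 1 = 1 := by
  rw [coeff_mul_apply_sum, Finset.sum_eq_single 1]
  · simp [coeff_colSum, coeff_rowSum]
  · intro σ _ hσ
    rw [coeff_colSum, coeff_rowSum]
    split_ifs with h h'
    · refine absurd (Equiv.ext fun k => t.injective (Subtype.ext (Prod.ext ?_ (h k)))) hσ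
      have := h' (σ k)
      simp only [mul_one, perm_inv_apply] at this
      exact this.symm
    · rw [mul_zero]
    · rw [zero_mul]
    · rw [zero_mul]
  · simp

theorem colSum_mul_rowSum_ne_zero (t : Tableau l) : colSum t * rowSum t ≠ 0 := fun h => by
  have := coeff_one_colSum_mul_rowSum t
  simp [h] at this

/-- By the trace property, its coefficient at 1 equals that of `C R R = r C R`, which is `r ≠ 0`. -/
theorem rowSum_mul_colSum_mul_rowSum_ne_zero (t : Tableau l) :
    rowSum t * colSum t * rowSum t ≠ 0 := fun h => by
  obtain ⟨r, hr, e⟩ := exists_rowSum_mul_rowSum t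
  have h' := coeff_one_mul_comm (rowSum t) (colSum t * rowSum t)
  rw [← mul_assoc, h, mul_assoc, e, mul_smul_comm, MonoidAlgebra.coeff_smul_apply,
    coeff_one_colSum_mul_rowSum] at h'
  simp [hr.symm] at h'

/-- The transposition of a bad pair preserves the columns of `t`, and its conjugate by `g⁻¹`
preserves the rows of `s`. Inserted before `g`, it is absorbed by the column sum with sign -1 and by
the row sum with sign +1, so the product equals its own negative. -/
theorem colSum_mul_single_mul_rowSum_eq_zero {t : Tableau l} {s : Tableau m}
    {g : Equiv.Perm (Fin n)} (h : ¬ Separated t (g⁻¹.trans s)) :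
    colSum t * single g 1 * rowSum s = 0 := by
  rw [Separated] at h
  push Not at h
  obtain ⟨i, j, hr, hc, hij⟩ := h
  have hτ : ∀ k, (t (Equiv.swap i j k)).1.2 = (t k).1.2 := by
    intro k
    rw [Equiv.swap_apply_def]
    split_ifs with h₁ h₂
    · rw [h₁, hc]
    · rw [h₂, hc]
    · rfl
  have hτ' : ∀ k, (s ((g⁻¹ * Equiv.swap i j * g) k)).1.1 = (s k).1.1 := by
    intro k
    simp only [Equiv.Perm.mul_apply, Equiv.trans_apply] at hr ⊢
    rw [Equiv.swap_apply_def]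
    split_ifs with h₁ h₂
    · rw [← hr, ← h₁, perm_inv_apply]
    · rw [hr, ← h₂, perm_inv_apply]
    · rw [perm_inv_apply]
  have e₁ : colSum t * single (Equiv.swap i j) 1 = -colSum t := by
    rw [colSum_mul_single hτ, Equiv.Perm.sign_swap hij]
    simp
  have e₂ : single (Equiv.swap i j) 1 * (single g 1 * rowSum s) = single g 1 * rowSum s := by
    conv_rhs => rw [← single_mul_rowSum hτ']
    rw [← mul_assoc, ← mul_assoc, MonoidAlgebra.single_mul_single, MonoidAlgebra.single_mul_single]
    simp [mul_assoc]
  have e₃ : colSum t * single g 1 * rowSum s = -(colSum t * single g 1 * rowSum s) := by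
    conv_lhs => rw [mul_assoc, ← e₂, ← mul_assoc, e₁, neg_mul, ← mul_assoc]
  have e₄ : (2 : ℂ) • (colSum t * single g 1 * rowSum s) = 0 := by
    rw [two_smul]
    nth_rewrite 1 [e₃]
    exact neg_add_cancel _
  exact (smul_eq_zero_iff_right two_ne_zero).1 e₄

/-- A symmetrizer of a tableau `t` kills the row sums of all tableaux of shapes that are not
dominated by the shape of `t`. -/
theorem colSum_mul_mul_rowSum_eq_zero (t : Tableau l) (s : Tableau m)
    (h : ∃ i, rowsHead l i < rowsHead m i) (x : CS n) : colSum t * x * rowSum s = 0 := by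
  induction x using MonoidAlgebra.induction_linear with
  | zero => simp
  | add x y hx hy => rw [mul_add, add_mul, hx, hy, add_zero]
  | single g r =>
    obtain ⟨i, hi⟩ := h
    rw [single_eq_smul, mul_smul_comm, smul_mul_assoc,
      colSum_mul_single_mul_rowSum_eq_zero fun hs => (hs.rowsHead_le i).not_gt hi, smul_zero]

/-- By linearity it suffices to take a permutation `g`. Either the product vanishes, or `g = q⁻¹
(g⁻¹ p g)` with `q⁻¹` preserving the columns and `g⁻¹ p g` preserving the rows of `t`, and these
factors are absorbed with the sign of `q⁻¹`. -/
theorem exists_colSum_mul_mul_rowSum (t : Tableau l) (x : CS n) :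
    ∃ r : ℂ, colSum t * x * rowSum t = r • (colSum t * rowSum t) := by
  induction x using MonoidAlgebra.induction_linear with
  | zero => exact ⟨0, by simp⟩
  | add x y hx hy =>
    obtain ⟨r, hr⟩ := hx
    obtain ⟨r', hr'⟩ := hy
    exact ⟨r + r', by rw [mul_add, add_mul, hr, hr', add_smul]⟩
  | single g r =>
    suffices h : ∃ r : ℂ, colSum t * single g 1 * rowSum t = r • (colSum t * rowSum t) by
      obtain ⟨r', hr'⟩ := h
      refine ⟨r * r', ?_⟩
      rw [single_eq_smul, mul_smul_comm, smul_mul_assoc,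
        hr', smul_smul]
    by_cases hs : Separated t (g⁻¹.trans t)
    · obtain ⟨q, p, hq, hp, hqp⟩ := hs.exists_perm
      have hp' : ∀ k, (t ((g⁻¹ * p * g) k)).1.1 = (t k).1.1 := by
        intro k
        have := hp (g k)
        simpa [Equiv.Perm.mul_apply] using this
      have hg : q = g⁻¹ * p := Equiv.ext fun k => t.injective (hqp k)
      have hq' : ∀ k, (t (q⁻¹ k)).1.2 = (t k).1.2 := fun k => by
        rw [← hq, perm_apply_inv]
      refine ⟨((Equiv.Perm.sign q⁻¹ : ℤ) : ℂ), ?_⟩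
      have e : single g 1 * rowSum t = single q⁻¹ 1 * rowSum t := by
        conv_rhs => rw [← single_mul_rowSum hp', ← mul_assoc, MonoidAlgebra.single_mul_single, hg]
        simp [mul_assoc]
      rw [← smul_mul_assoc, ← colSum_mul_single hq', mul_assoc, mul_assoc, e]
    · exact ⟨0, by rw [colSum_mul_single_mul_rowSum_eq_zero hs, zero_smul]⟩

/-- Relabelling a tableau by `g` conjugates its row group. With the column version below, this
passes between different tableaux of one shape. -/
theorem single_mul_rowSum_trans (t : Tableau l) (g : Equiv.Perm (Fin n)) :
    single g 1 * rowSum (g.trans t) = rowSum t * single g 1 := by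
  ext σ
  rw [coeff_single_mul', coeff_mul_single', coeff_rowSum, coeff_rowSum]
  congr 1
  refine propext ⟨fun h k => ?_, fun h k => ?_⟩
  · simpa using h (g⁻¹ k)
  · simpa using h (g k)

theorem single_mul_colSum_trans (t : Tableau l) (g : Equiv.Perm (Fin n)) :
    single g 1 * colSum (g.trans t) = colSum t * single g 1 := by
  ext σ
  rw [coeff_single_mul', coeff_mul_single', coeff_colSum, coeff_colSum]
  have h : Equiv.Perm.sign (g⁻¹ * σ) = Equiv.Perm.sign (σ * g⁻¹) := by
    rw [map_mul, map_mul, mul_comm]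
  rw [h]
  congr 1
  refine propext ⟨fun h k => ?_, fun h k => ?_⟩
  · simpa using h (g⁻¹ k)
  · simpa using h (g k)

end Symmetrizer

/-! ### Simplicity of the Specht modules -/

section Specht

variable {n : ℕ} {l m : Ptn n}

/-- The group algebra is von Neumann regular. -/
theorem exists_mul_mul_self (u : CS n) : ∃ y : CS n, u * y * u = u := by
  -- By semisimplicity the left ideal of `u` is generated by an idempotent `e`. Writing `e = y u`
  -- and `u = z e` gives `u y u = z e e = u`.
  obtain ⟨e, he, h⟩ := IsSemisimpleRing.ideal_eq_span_idempotent (Ideal.span {u})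
  obtain ⟨y, hy⟩ := Ideal.mem_span_singleton'.1 (h.symm ▸ Ideal.mem_span_singleton_self e :
    e ∈ Ideal.span {u})
  obtain ⟨z, hz⟩ := Ideal.mem_span_singleton'.1 (h ▸ Ideal.mem_span_singleton_self u :
    u ∈ Ideal.span {e})
  refine ⟨y, ?_⟩
  rw [mul_assoc, hy, ← hz, mul_assoc, he.eq]

theorem mem_specht {t : Tableau l} {x : CS n} :
    x ∈ Specht t ↔ ∃ y, y * (colSum t * rowSum t) = x :=
  Submodule.mem_span_singleton

theorem symmetrizer_mem_specht (t : Tableau l) : colSum t * rowSum t ∈ Specht t :=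
  Submodule.mem_span_singleton_self _

/-- This is the simplicity of the Specht module: every nonzero element generates the symmetrizer
`c`. For `u = x c` choose `y` with `u y u = u`. Then `c y u` has the form `C (…) R`, so it is a
multiple `r c`, and `r = 0` would give `u = u y u = x (c y u) = 0`. -/
theorem exists_mul_eq_symmetrizer {t : Tableau l} {u : CS n} (hu : u ∈ Specht t) (hu0 : u ≠ 0) :
    ∃ y, y * u = colSum t * rowSum t := by
  obtain ⟨x, rfl⟩ := mem_specht.1 hu
  obtain ⟨y, hy⟩ := exists_mul_mul_self (x * (colSum t * rowSum t))
  obtain ⟨r, hr⟩ := exists_colSum_mul_mul_rowSum t (rowSum t * y * x * colSum t)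
  have e : colSum t * rowSum t * y * (x * (colSum t * rowSum t)) = r • (colSum t * rowSum t) := by
    rw [← hr]
    simp only [mul_assoc]
  have hr0 : r ≠ 0 := by
    rintro rfl
    rw [mul_assoc, mul_assoc, ← mul_assoc (colSum t * rowSum t), e, zero_smul, mul_zero] at hy
    exact hu0 hy.symm
  refine ⟨r⁻¹ • (colSum t * rowSum t * y), ?_⟩
  rw [smul_mul_assoc, e, smul_smul, inv_mul_cancel₀ hr0, one_smul]

instance nontrivial_specht (t : Tableau l) : Nontrivial (Specht t) :=
  ⟨⟨_, symmetrizer_mem_specht t⟩, 0, fun h =>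
    colSum_mul_rowSum_ne_zero t (congrArg Subtype.val h)⟩

instance isSimpleModule_specht (t : Tableau l) : IsSimpleModule (CS n) (Specht t) := by
  refine isSimpleModule_iff_toSpanSingleton_surjective.2 ⟨inferInstance, fun u hu v => ?_⟩
  obtain ⟨y, hy⟩ := exists_mul_eq_symmetrizer u.2 fun h => hu (Subtype.ext h)
  obtain ⟨z, hz⟩ := mem_specht.1 v.2
  exact ⟨z * y, Subtype.ext (by rw [← hz, ← hy, ← mul_assoc]; rfl)⟩

/-- The column sum of `t` acts on the generator of `Specht t` by a nonzero scalar, but it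
annihilates all of `Specht s`, so the generator is mapped to 0. -/
theorem specht_hom_eq_zero_of_lt {t : Tableau l} {s : Tableau m}
    (h : ∃ i, rowsHead l i < rowsHead m i) (f : Specht t →ₗ[CS n] Specht s) : f = 0 := by
  obtain ⟨r, hr, e⟩ := exists_colSum_mul_colSum t
  let c : Specht t := ⟨_, symmetrizer_mem_specht t⟩
  have hc : colSum t • c = r • c := Subtype.ext <| by
    change colSum t * (colSum t * rowSum t) = r • (colSum t * rowSum t)
    rw [← mul_assoc, e, smul_mul_assoc]
  have hf : f c = 0 := by
    have h₁ : colSum t • f c = r • f c := by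
      rw [← map_smul, hc, LinearMap.map_smul_of_tower]
    obtain ⟨y, hy⟩ := mem_specht.1 (f c).2
    have h₂ : colSum t • f c = 0 := Subtype.ext <| by
      rw [Submodule.coe_smul, smul_eq_mul, ← hy, ← mul_assoc, ← mul_assoc, mul_assoc (colSum t)]
      exact colSum_mul_mul_rowSum_eq_zero t s h _
    rw [h₂] at h₁
    exact (smul_eq_zero_iff_right hr).1 h₁.symm
  refine LinearMap.ext fun ⟨v, hv⟩ => ?_
  obtain ⟨z, rfl⟩ := mem_specht.1 hv
  exact (map_smul f z c).trans (by rw [hf, smul_zero, LinearMap.zero_apply])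

/-- There are no nonzero homomorphisms between Specht modules of different shapes. -/
theorem specht_hom_eq_zero {t : Tableau l} {s : Tableau m} (h : l ≠ m)
    (f : Specht t →ₗ[CS n] Specht s) : f = 0 := by
  by_cases hlt : ∃ i, rowsHead l i < rowsHead m i
  · exact specht_hom_eq_zero_of_lt hlt f
  · have hgt : ∃ i, rowsHead m i < rowsHead l i := by
      by_contra hgt
      push Not at hlt hgt
      exact h (eq_of_rowsHead_eq fun i => le_antisymm (hgt i) (hlt i))
    -- By simplicity a nonzero `f` would be invertible, and its inverse goes in the direction
    -- already excluded.
    rcases LinearMap.bijective_or_eq_zero f with hf | hf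
    · have hg := specht_hom_eq_zero_of_lt hgt (LinearEquiv.ofBijective f hf).symm.toLinearMap
      refine LinearMap.ext fun v => ?_
      have := LinearMap.congr_fun hg (f v)
      simp only [LinearEquiv.coe_coe, LinearMap.zero_apply] at this
      rw [show f v = LinearEquiv.ofBijective f hf v from rfl,
        LinearEquiv.symm_apply_apply] at this
      rw [this, map_zero, LinearMap.zero_apply]
    · exact hf

theorem exists_specht_end_eq_smul {t : Tableau l} (f : Module.End (CS n) (Specht t)) :
    ∃ r : ℂ, ∀ v, f v = r • v := by
  obtain ⟨r, hr⟩ := (IsSimpleModule.algebraMap_end_bijective_of_isAlgClosed ℂ).2 f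
  exact ⟨r, fun v => by rw [← hr]; rfl⟩

end Specht

/-! ### The group algebra as a product of matrix algebras -/

section Density

variable {n : ℕ} (T : ∀ l : Ptn n, Tableau l)

/-- Every family of linear endomorphisms of the Specht modules is given by an element of the group
algebra. -/
theorem exists_smul_eq (f : ∀ l : Ptn n, Module.End ℂ (Specht (T l))) :
    ∃ a : CS n, ∀ (l : Ptn n) (v : Specht (T l)), a • v = f l v := by
  classical
  have := Fintype.ofFinite (Ptn n)
  let M := ∀ l : Ptn n, Specht (T l)
  have comm (θ : Module.End (CS n) M) (v : M) :
      (fun l => f l (θ v l)) = θ fun l => f l (v l) := by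
    -- An endomorphism `θ` of the sum of all Specht modules has no off-diagonal components, and its
    -- diagonal ones are scalars; hence it commutes with any componentwise linear map.
    have key (l : Ptn n) : ∃ r : ℂ, ∀ v, θ v l = r • v l := by
      obtain ⟨r, hr⟩ := exists_specht_end_eq_smul
        (LinearMap.proj l ∘ₗ θ ∘ₗ LinearMap.single (CS n) (fun l => Specht (T l)) l)
      refine ⟨r, fun v => ?_⟩
      have hv : v = ∑ m, Pi.single m (v m) := (Finset.univ_sum_single v).symm
      conv_lhs => rw [hv, map_sum, Finset.sum_apply]
      rw [Finset.sum_eq_single l]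
      · exact hr (v l)
      · intro m _ hml
        exact LinearMap.congr_fun (specht_hom_eq_zero hml
          (LinearMap.proj l ∘ₗ θ ∘ₗ LinearMap.single (CS n) (fun l => Specht (T l)) m)) (v m)
      · simp
    funext l
    obtain ⟨r, hr⟩ := key l
    rw [hr, hr, map_smul]
  let F : Module.End (Module.End (CS n) M) M :=
    { toFun := fun v l => f l (v l)
      map_add' := fun v w => funext fun l => map_add _ _ _
      map_smul' := fun θ v => comm θ v }
  have hfin : Module.Finite ℂ M := inferInstance
  obtain ⟨s, hs⟩ := hfin.fg_top
  -- Density matches `F` with some `a` on a finite set; as `s` spans over `ℂ` and both sides are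
  -- `ℂ`-linear, they agree everywhere.
  obtain ⟨a, ha⟩ := jacobson_density F s
  have ha' (v : M) : F v = a • v := by
    have hv : v ∈ Submodule.span ℂ (s : Set M) := hs ▸ trivial
    induction hv using Submodule.span_induction with
    | mem v hv => exact ha v hv
    | zero => rw [map_zero, smul_zero]
    | add v w _ _ hv hw => rw [map_add, hv, hw, smul_add]
    | smul r v _ hv =>
      rw [smul_comm, ← hv]
      exact funext fun l => map_smul (f l) r (v l)
  refine ⟨a, fun l v => ?_⟩
  have := congrFun (ha' (Pi.single l v)) l
  rw [Pi.smul_apply, Pi.single_eq_same] at this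
  rw [← this]
  exact congrArg (f l) (Pi.single_eq_same (M := fun l => Specht (T l)) l v)

/-- The sum of the conjugates of an element of the group algebra. -/
def conjSum (x : CS n) : CS n :=
  ∑ σ : Equiv.Perm (Fin n), single σ 1 * x * single σ⁻¹ 1

theorem conjSum_mem_center (x : CS n) : conjSum x ∈ Subalgebra.center ℂ (CS n) := by
  have key (τ : Equiv.Perm (Fin n)) : single τ 1 * conjSum x = conjSum x * single τ 1 := by
    rw [conjSum, Finset.mul_sum, Finset.sum_mul]
    conv_rhs => rw [← Equiv.sum_comp (Equiv.mulLeft τ)]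
    refine Finset.sum_congr rfl fun σ _ => ?_
    rw [Equiv.coe_mulLeft, mul_inv_rev, mul_assoc _ (single (σ⁻¹ * τ⁻¹) 1),
      MonoidAlgebra.single_mul_single, inv_mul_cancel_right, ← mul_assoc, ← mul_assoc,
      MonoidAlgebra.single_mul_single, mul_one]
  refine Subalgebra.mem_center_iff.2 fun y => ?_
  induction y using MonoidAlgebra.induction_linear with
  | zero => simp
  | add x y hx hy => rw [mul_add, add_mul, hx, hy]
  | single τ r => rw [single_eq_smul, smul_mul_assoc, mul_smul_comm, key]

/-- The coefficients of a central element are constant on conjugacy classes, so its values at class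
representatives determine it. -/
theorem finrank_center_le : Module.finrank ℂ (Subalgebra.center ℂ (CS n)) ≤ Nat.card (Ptn n) := by
  classical
  refine le_trans ?_ (card_conjClasses_le n)
  let Φ : Subalgebra.center ℂ (CS n) →ₗ[ℂ] (ConjClasses (Equiv.Perm (Fin n)) → ℂ) :=
    { toFun := fun z c => z.1.coeff c.out
      map_add' := fun z w => rfl
      map_smul' := fun r z => rfl }
  have hΦ : Function.Injective Φ := by
    refine (injective_iff_map_eq_zero _).2 fun z hz => Subtype.ext (MonoidAlgebra.ext (Finsupp.ext fun σ => ?_))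
    obtain ⟨τ, hτ⟩ := isConj_iff.1 (ConjClasses.mk_eq_mk_iff_isConj.1
      (Quotient.out_eq (ConjClasses.mk σ)))
    have h := Subalgebra.mem_center_iff.1 z.2 (single τ 1)
    have h₁ : z.1.coeff (ConjClasses.mk σ).out = 0 := congrFun hz (ConjClasses.mk σ)
    have h₂ := congrArg (fun x : CS n => x.coeff (σ * τ)) h
    simp only [coeff_single_mul', coeff_mul_single', mul_inv_cancel_right] at h₂
    rw [← h₂, ← hτ]
    simpa [mul_assoc] using h₁
  have := LinearMap.finrank_le_finrank_of_injective hΦ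
  rwa [Module.finrank_fintype_fun_eq_card, ← Nat.card_eq_fintype_card] at this

/-- The group algebra acts faithfully on the sum of the Specht modules. -/
theorem eq_zero_of_smul_eq_zero {a : CS n} (ha : ∀ (l : Ptn n) (v : Specht (T l)), a • v = 0) :
    a = 0 := by
  classical
  have := Fintype.ofFinite (Ptn n)
  -- A nonzero `a` acting as 0 would give one central element too many. Averaging over conjugates,
  -- the `e m` become central elements acting by `N` on the `m`-th Specht module and by 0 on the
  -- others, and `σ⁻¹ a` becomes a central `b` that acts as 0 but has coefficient `N * a.coeff σ ≠
  -- 0` at 1. Together they are linearly independent, against `finrank_center_le`.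
  by_contra ha0
  obtain ⟨σ, hσ⟩ : ∃ σ, a.coeff σ ≠ 0 := by
    by_contra! h
    exact ha0 (MonoidAlgebra.ext (Finsupp.ext h))
  let N : ℂ := Fintype.card (Equiv.Perm (Fin n))
  have hN : N ≠ 0 := Nat.cast_ne_zero.2 Fintype.card_ne_zero
  have smul_conjSum (x : CS n) (l : Ptn n) (r : ℂ) (hx : ∀ v : Specht (T l), x • v = r • v)
      (v : Specht (T l)) : conjSum x • v = (N * r) • v := by
    have h (τ : Equiv.Perm (Fin n)) : (single τ 1 * x * single τ⁻¹ 1 : CS n) • v = r • v := by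
      rw [mul_smul, mul_smul, hx, smul_comm, smul_smul, MonoidAlgebra.single_mul_single,
        mul_inv_cancel, mul_one, ← MonoidAlgebra.one_def, one_smul]
    rw [conjSum, Finset.sum_smul, Finset.sum_congr rfl fun τ _ => h τ, Finset.sum_const,
      Finset.card_univ, ← Nat.cast_smul_eq_nsmul ℂ, smul_smul]
  choose e he using fun m : Ptn n => exists_smul_eq T fun l => if l = m then 1 else 0
  have he' (m l : Ptn n) (v : Specht (T l)) : conjSum (e m) • v = (if l = m then N else 0) • v := by
    rw [smul_conjSum (e m) l (if l = m then 1 else 0)]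
    · split_ifs <;> simp
    · intro v
      rw [he]
      split_ifs <;> simp
  let b : CS n := conjSum (single σ⁻¹ 1 * a)
  have hb (l : Ptn n) (v : Specht (T l)) : b • v = 0 := by
    rw [smul_conjSum _ l 0, mul_zero, zero_smul]
    intro v
    rw [mul_smul, ha, smul_zero, zero_smul]
  have hb0 : b ≠ 0 := by
    intro h
    have h' := congrArg (fun x : CS n => x.coeff 1) h
    simp only [b, conjSum, MonoidAlgebra.coeff_sum, Finsupp.finsetSum_apply, coeff_single_mul',
      coeff_mul_single'] at h'
    simp [hσ] at h'
  have hli : LinearIndependent ℂ (fun o : Option (Ptn n) =>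
      (o.elim ⟨b, conjSum_mem_center _⟩ fun m => ⟨conjSum (e m), conjSum_mem_center _⟩ :
        Subalgebra.center ℂ (CS n))) := by
    rw [Fintype.linearIndependent_iff]
    intro c hc
    rw [Fintype.sum_option] at hc
    have hc' : c none • b + ∑ m, c (some m) • conjSum (e m) = 0 := by
      have := congrArg Subtype.val hc
      simpa using this
    have hsome (m : Ptn n) : c (some m) = 0 := by
      obtain ⟨v, hv⟩ := exists_ne (0 : Specht (T m))
      have h := congrArg (fun x : CS n => x • v) hc'
      simp only [add_smul, Finset.sum_smul, smul_assoc, hb, he', smul_zero, zero_add,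
        zero_smul] at h
      rw [Finset.sum_eq_single m] at h
      · rw [if_pos rfl, smul_smul] at h
        rcases smul_eq_zero.1 h with h | h
        · exact (mul_eq_zero.1 h).resolve_right hN
        · exact absurd h hv
      · intro m' _ hm'
        rw [if_neg hm'.symm, zero_smul, smul_zero]
      · simp
    rintro (_ | m)
    · simp only [hsome, zero_smul, Finset.sum_const_zero, add_zero] at hc'
      exact (smul_eq_zero.1 hc').resolve_right hb0
    · exact hsome m
  have h₁ := hli.fintype_card_le_finrank
  have h₂ := finrank_center_le (n := n)
  rw [Nat.card_eq_fintype_card] at h₂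
  rw [Fintype.card_option] at h₁
  omega

end Density

/-! ### The sign twist -/

section Twist

variable {n : ℕ} {l m : Ptn n}

/-- The sign of a permutation, as a complex number. -/
abbrev csign (σ : Equiv.Perm (Fin n)) : ℂ := ((Equiv.Perm.sign σ : ℤ) : ℂ)

/-- The automorphism `σ ↦ sgn(σ) σ` of the group algebra. -/
def signTwist (n : ℕ) : CS n →ₐ[ℂ] CS n :=
  MonoidAlgebra.lift ℂ (CS n) (Equiv.Perm (Fin n))
    { toFun := fun σ => single σ (csign σ)
      map_one' := by simp [MonoidAlgebra.one_def]
      map_mul' := fun σ τ => by simp [csign, MonoidAlgebra.single_mul_single] }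

theorem signTwist_single (σ : Equiv.Perm (Fin n)) :
    signTwist n (single σ 1) = csign σ • single σ 1 := by
  rw [signTwist, MonoidAlgebra.lift_single, one_smul, ← single_eq_smul]
  rfl

theorem coeff_signTwist (x : CS n) (σ : Equiv.Perm (Fin n)) :
    (signTwist n x).coeff σ = csign σ * x.coeff σ := by
  induction x using MonoidAlgebra.induction_linear with
  | zero => simp
  | add x y hx hy => simp only [map_add, MonoidAlgebra.coeff_add, Finsupp.add_apply, hx, hy, mul_add]
  | single τ r =>
    rw [single_eq_smul, map_smul, signTwist_single]
    by_cases h : τ = σ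
    · subst h
      simp [mul_comm]
    · simp [Finsupp.single_eq_of_ne' h]

theorem signTwist_signTwist (x : CS n) : signTwist n (signTwist n x) = x := by
  refine MonoidAlgebra.ext (Finsupp.ext fun σ => ?_)
  rw [coeff_signTwist, coeff_signTwist, ← mul_assoc, sign_mul_self, one_mul]

theorem csign_eq_ksign (σ : Equiv.Perm (Fin n)) : csign σ = ksign (permDeg σ) 1 := by
  obtain ⟨-, s₀, -, s₁⟩ := ksign_cases
  rcases Int.units_eq_one_or (Equiv.Perm.sign σ) with h | h <;> simp [csign, permDeg, h, s₀, s₁]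

/-- This links the twist to the grading: homogeneous elements are eigenvectors of the twist, with
eigenvalue given by their parity. -/
theorem signTwist_of_mem {i : ZMod 2} {a : CS n} (ha : a ∈ Superspace.part (V := CS n) i) :
    signTwist n a = ksign i 1 • a := by
  refine MonoidAlgebra.ext (Finsupp.ext fun σ => ?_)
  rw [coeff_signTwist, MonoidAlgebra.coeff_smul_apply, smul_eq_mul, csign_eq_ksign]
  by_cases h : permDeg σ = i
  · rw [h]
  · rw [ha σ h, mul_zero, mul_zero]

/-- The transpose of a tableau. -/
def transposeTableau (t : Tableau l) : Tableau l.conj :=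
  t.trans ((Equiv.prodComm ℕ ℕ).subtypeEquiv fun c => by
    rw [YoungDiagram.mem_cells, YoungDiagram.mem_cells]
    exact (YoungDiagram.mem_transpose (c := c.swap)).symm)

theorem signTwist_rowSum (t : Tableau l) :
    signTwist n (rowSum t) = colSum (transposeTableau t) := by
  refine MonoidAlgebra.ext (Finsupp.ext fun σ => ?_)
  rw [coeff_signTwist, coeff_rowSum, coeff_colSum, mul_ite, mul_one, mul_zero]
  rfl

theorem signTwist_colSum (t : Tableau l) :
    signTwist n (colSum t) = rowSum (transposeTableau t) := by
  refine MonoidAlgebra.ext (Finsupp.ext fun σ => ?_)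
  rw [coeff_signTwist, coeff_rowSum, coeff_colSum, mul_ite, sign_mul_self, mul_zero]
  rfl

/-- A linear map `f` with `f (σ v) = sgn(σ) σ f(v)` for all permutations `σ`. -/
def IsTwisted {U V : Submodule (CS n) (CS n)} (f : U →ₗ[ℂ] V) : Prop :=
  ∀ (a : CS n) (u : U), f (a • u) = signTwist n a • f u

theorem isTwisted_of_single {U V : Submodule (CS n) (CS n)} {f : U →ₗ[ℂ] V}
    (h : ∀ (σ : Equiv.Perm (Fin n)) (u : U),
      f ((single σ 1 : CS n) • u) = csign σ • (single σ 1 : CS n) • f u) : IsTwisted f := by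
  intro a u
  induction a using MonoidAlgebra.induction_linear with
  | zero => simp
  | add x y hx hy => rw [add_smul, map_add, hx, hy, map_add, add_smul]
  | single τ r =>
    rw [single_eq_smul, smul_assoc, map_smul, h, map_smul, signTwist_single, smul_assoc, smul_assoc]

/-- The twist carries `C_t R_t` to `R_{t'} C_{t'}`. Right multiplication by `R_{t'} g`, with `g`
relabelling `t'` to `s`, turns this into `R_{t'} g C_s R_s`, which lies in `Specht s`. The resulting
map is nonzero because `R_{t'} C_{t'} R_{t'} ≠ 0`, and simplicity of both modules makes it
bijective. -/
theorem exists_isTwisted (t : Tableau l) (s : Tableau l.conj) :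
    ∃ f : Specht t →ₗ[ℂ] Specht s, IsTwisted f ∧ Function.Bijective f := by
  let t' := transposeTableau t
  let g : Equiv.Perm (Fin n) := s.trans t'.symm
  have hs : g.trans t' = s := by ext k : 1; simp [g]
  have ha : single g 1 * rowSum s = rowSum t' * single g 1 := by
    rw [← single_mul_rowSum_trans, hs]
  have hb : single g 1 * colSum s = colSum t' * single g 1 := by
    rw [← single_mul_colSum_trans, hs]
  let w : CS n := rowSum t' * single g 1
  have hw (y : CS n) : signTwist n (y * (colSum t * rowSum t)) * w =
      signTwist n y * rowSum t' * single g 1 * (colSum s * rowSum s) := by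
    rw [map_mul, map_mul, signTwist_rowSum, signTwist_colSum]
    simp only [w, mul_assoc]
    rw [← mul_assoc (single g 1) (colSum s), hb, mul_assoc (colSum t'), ha]
  let f : Specht t →ₗ[ℂ] Specht s :=
    { toFun := fun x => ⟨signTwist n x.1 * w, by
        obtain ⟨y, hy⟩ := mem_specht.1 x.2
        rw [← hy, hw]
        exact mem_specht.2 ⟨_, rfl⟩⟩
      map_add' := fun x y => Subtype.ext (by simp [add_mul])
      map_smul' := fun r x => Subtype.ext (by simp) }
  have hf : IsTwisted f := fun a u => Subtype.ext (by simp [f, mul_assoc])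
  let c : Specht t := ⟨_, symmetrizer_mem_specht t⟩
  have hc : f c ≠ 0 := fun h => by
    have h₁ : signTwist n (colSum t * rowSum t) * w = 0 := congrArg Subtype.val h
    rw [map_mul, signTwist_rowSum, signTwist_colSum] at h₁
    have h₂ := congrArg (· * single g⁻¹ 1) h₁
    simp only [w, mul_assoc, MonoidAlgebra.single_mul_single, mul_inv_cancel, mul_one, zero_mul,
      ← MonoidAlgebra.one_def] at h₂
    exact rowSum_mul_colSum_mul_rowSum_ne_zero t' ((mul_assoc _ _ _).trans h₂)
  refine ⟨f, hf, (injective_iff_map_eq_zero _).2 fun u hu => ?_, fun v => ?_⟩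
  · by_contra hu0
    obtain ⟨y, hy⟩ := exists_mul_eq_symmetrizer u.2 fun h => hu0 (Subtype.ext h)
    have : y • u = c := Subtype.ext hy
    exact hc (by rw [← this, hf, hu, smul_zero])
  · obtain ⟨y, hy⟩ := exists_mul_eq_symmetrizer (f c).2 fun h => hc (Subtype.ext h)
    obtain ⟨z, hz⟩ := mem_specht.1 v.2
    refine ⟨signTwist n (z * y) • c, ?_⟩
    rw [hf, signTwist_signTwist]
    exact Subtype.ext (by rw [← hz, ← hy, ← mul_assoc]; rfl)

/-- The identity map between the Specht modules of equal shapes. -/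
def spechtCast (T : ∀ l : Ptn n, Tableau l) (h : m = l) : Specht (T m) →ₗ[CS n] Specht (T l) :=
  Submodule.inclusion (specht_congr h).le

theorem coe_spechtCast (T : ∀ l : Ptn n, Tableau l) (h : m = l) (v : Specht (T m)) :
    (spechtCast T h v : CS n) = v :=
  Submodule.coe_inclusion _ v

theorem spechtCast_smul (T : ∀ l : Ptn n, Tableau l) (h : m = l) (r : ℂ) (v : Specht (T m)) :
    spechtCast T h (r • v) = r • spechtCast T h v :=
  LinearMap.map_smul_of_tower _ r v

theorem spechtCast_injective (T : ∀ l : Ptn n, Tableau l) (h : m = l) :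
    Function.Injective (spechtCast T h) :=
  Submodule.inclusion_injective _

/-- Two sign twists cancel, so the square of `f` is linear over the group algebra and Schur's lemma
applies. -/
theorem exists_eq_smul_of_isTwisted (T : ∀ l : Ptn n, Tableau l) (h : l.conj = l)
    {f : Specht (T l) →ₗ[ℂ] Specht (T l.conj)} (hf : IsTwisted f) (hb : Function.Injective f) :
    ∃ r : ℂ, r ≠ 0 ∧ ∀ v, spechtCast T h (f (spechtCast T h (f v))) = r • v := by
  let F : Module.End (CS n) (Specht (T l)) :=
    { toFun := fun v => spechtCast T h (f (spechtCast T h (f v)))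
      map_add' := fun v w => by simp only [map_add]
      map_smul' := fun a v => by
        rw [hf, map_smul, hf, signTwist_signTwist, map_smul, RingHom.id_apply] }
  obtain ⟨r, hr⟩ := exists_specht_end_eq_smul F
  refine ⟨r, ?_, hr⟩
  rintro rfl
  obtain ⟨v, hv⟩ := exists_ne (0 : Specht (T l))
  refine hv (hb (spechtCast_injective T h (hb (spechtCast_injective T h ?_))))
  rw [map_zero, map_zero, map_zero, map_zero]
  exact (hr v).trans (zero_smul ℂ v)

theorem exists_isTwisted_involutive (T : ∀ l : Ptn n, Tableau l) (l : Ptn n) :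
    ∃ f : Specht (T l) →ₗ[ℂ] Specht (T l.conj), IsTwisted f ∧ Function.Bijective f ∧
      ∀ (h : l.conj = l) (v : Specht (T l)), spechtCast T h (f (spechtCast T h (f v))) = v := by
  obtain ⟨f, hf, hb⟩ := exists_isTwisted (T l) (T l.conj)
  by_cases h : l.conj = l
  · obtain ⟨r, hr0, hr⟩ := exists_eq_smul_of_isTwisted T h hf hb.1
    -- Dividing `f` by a square root of `r` turns its square into the identity.
    obtain ⟨s, hs⟩ := IsAlgClosed.exists_pow_nat_eq r (n := 2) two_pos
    have hs0 : s ≠ 0 := by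
      rintro rfl
      exact hr0 (by rw [← hs]; simp)
    refine ⟨s⁻¹ • f, fun a u => ?_, ?_, fun _ v => ?_⟩
    · rw [LinearMap.smul_apply, hf, LinearMap.smul_apply, smul_comm]
    · refine ⟨fun x y hxy => hb.1 ?_, fun y => ?_⟩
      · exact smul_right_injective _ (inv_ne_zero hs0) hxy
      · obtain ⟨x, hx⟩ := hb.2 (s • y)
        exact ⟨x, by rw [LinearMap.smul_apply, hx, smul_smul, inv_mul_cancel₀ hs0, one_smul]⟩
    · rw [LinearMap.smul_apply, LinearMap.smul_apply, spechtCast_smul, spechtCast_smul, map_smul,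
        spechtCast_smul, hr, smul_smul, smul_smul, ← hs]
      have : s⁻¹ * s⁻¹ * s ^ 2 = 1 := by field_simp
      rw [this, one_smul]
  · exact ⟨f, hf, hb, fun h' => absurd h' h⟩

theorem conj_conj (l : Ptn n) : l.conj.conj = l := Subtype.ext (YoungDiagram.transpose_transpose _)

/-- The shapes `l.conj.conj` and `l` are equal only propositionally; values are therefore compared
inside the group algebra. -/
theorem specht_map_congr {T : ∀ l : Ptn n, Tableau l}
    (F : ∀ l : Ptn n, Specht (T l) → Specht (T l.conj)) (h : m = l) (w : Specht (T m))
    (u : Specht (T l)) (hu : (w : CS n) = u) : (F m w : CS n) = F l u := by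
  subst h
  rw [Subtype.ext hu]

theorem specht_map_congr' {T : ∀ l : Ptn n, Tableau l}
    (F : ∀ l : Ptn n, Specht (T l.conj) → Specht (T l)) (h : m = l) (w : Specht (T m.conj))
    (u : Specht (T l.conj)) (hu : (w : CS n) = u) : (F m w : CS n) = F l u := by
  subst h
  rw [Subtype.ext hu]

/-- For `l ∈ P` the twisted map `f l` is used, and for `l ∉ P` the inverse of the one for `l.conj`.
The two choices are then mutually inverse by construction, except for self-conjugate shapes, where
`f l` is an involution. -/
theorem nonempty_associator {P : Set (Ptn n)} (hP : IsConjReps P) (T : ∀ l : Ptn n, Tableau l) :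
    Nonempty (Associator T) := by
  classical
  choose f hf hb hi using exists_isTwisted_involutive T
  let e (l : Ptn n) : Specht (T l) ≃ₗ[ℂ] Specht (T l.conj) := LinearEquiv.ofBijective (f l) (hb l)
  let φ (l : Ptn n) : Specht (T l) →ₗ[ℂ] Specht (T l.conj) :=
    if l ∈ P then f l else
      (e l.conj).symm.toLinearMap ∘ₗ (spechtCast T (conj_conj l).symm).restrictScalars ℂ
  have hφ (l : Ptn n) : IsTwisted (φ l) := by
    by_cases h : l ∈ P
    · simp only [φ, if_pos h]
      exact hf l
    · simp only [φ, if_neg h]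
      intro a u
      refine (e l.conj).injective ?_
      -- The inverse of a twisted map is twisted, because twisting `a` twice returns `a`.
      have h₁ := hf l.conj (signTwist n a) ((e l.conj).symm (spechtCast T (conj_conj l).symm u))
      rw [signTwist_signTwist] at h₁
      rw [LinearMap.comp_apply, LinearMap.comp_apply, LinearEquiv.coe_coe,
        LinearEquiv.apply_symm_apply, LinearMap.restrictScalars_apply,
        LinearMap.restrictScalars_apply, map_smul]
      refine Eq.trans ?_ h₁.symm
      exact congrArg (a • ·) ((e l.conj).apply_symm_apply _).symm
  refine ⟨⟨φ, fun l σ v => ?_, fun l v => ?_⟩⟩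
  · rw [hφ, signTwist_single, smul_assoc]
  · by_cases h : l ∈ P
    · have e₁ : φ l v = f l v := by simp only [φ, if_pos h]
      rw [e₁]
      by_cases h' : l.conj ∈ P
      · have hl : l.conj = l := (hP l).unique ⟨h', Or.inr rfl⟩ ⟨h, Or.inl rfl⟩
        simp only [φ, if_pos h']
        rw [specht_map_congr (fun l => f l) hl (f l v) (spechtCast T hl (f l v))
          (coe_spechtCast T hl _).symm]
        exact (coe_spechtCast T hl _).symm.trans (congrArg Subtype.val (hi l hl v))
      · simp only [φ, if_neg h']
        rw [LinearMap.comp_apply, LinearMap.restrictScalars_apply, LinearEquiv.coe_coe]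
        refine (specht_map_congr' (fun l => (e l).symm) (conj_conj l) _ (f l v)
          (coe_spechtCast T _ _)).trans ?_
        exact congrArg Subtype.val ((e l).symm_apply_apply v)
    · have h' : l.conj ∈ P := by
        obtain ⟨m, ⟨hm, rfl | rfl⟩, -⟩ := hP l
        · exact absurd hm h
        · exact hm
      simp only [φ, if_pos h', if_neg h]
      rw [LinearMap.comp_apply, LinearMap.restrictScalars_apply, LinearEquiv.coe_coe]
      refine (congrArg Subtype.val ((e l.conj).apply_symm_apply _)).trans ?_
      exact coe_spechtCast T _ v

end Twist

/-! ### Isomorphisms of superalgebras and Lie superalgebras -/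

section Lie

/-- An even linear isomorphism that respects the brackets of homogeneous elements is an isomorphism
of Lie superalgebras. -/
def LieSuperEquiv.ofHomogeneous {L M : Type*} [AddCommGroup L] [Module ℂ L] [LieSuperalgebra L]
    [AddCommGroup M] [Module ℂ M] [LieSuperalgebra M] (e : L ≃ₗ[ℂ] M)
    (h : ∀ (i : ZMod 2) (x : L), x ∈ Superspace.part (V := L) i →
      e x ∈ Superspace.part (V := M) i)
    (hb : ∀ (i j : ZMod 2) (x y : L), x ∈ Superspace.part (V := L) i →
      y ∈ Superspace.part (V := L) j →
      e (LieSuperalgebra.bracket x y) = LieSuperalgebra.bracket (e x) (e y)) :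
    LieSuperEquiv L M where
  toLinearEquiv := e
  map_part := h
  map_bracket x y := by
    change e (LieSuperalgebra.bracket x y) = LieSuperalgebra.bracket (e x) (e y)
    rw [← proj_zero_add_proj_one x, ← proj_zero_add_proj_one y]
    simp only [map_add, LinearMap.add_apply]
    rw [hb _ _ _ _ (proj_mem 0 x) (proj_mem 0 y), hb _ _ _ _ (proj_mem 0 x) (proj_mem 1 y),
      hb _ _ _ _ (proj_mem 1 x) (proj_mem 0 y), hb _ _ _ _ (proj_mem 1 x) (proj_mem 1 y)]

variable {ι κ A : Type*} {B : ι → Type*} {C : κ → Type*} [Ring A] [Algebra ℂ A] [Superalgebra A]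
  [∀ k, Ring (B k)] [∀ k, Algebra ℂ (B k)] [∀ k, Superalgebra (B k)]
  [∀ k, Ring (C k)] [∀ k, Algebra ℂ (C k)] [∀ k, Superalgebra (C k)]

theorem LieOf.bracket_of_mem {i j : ZMod 2} {x y : A} (hx : x ∈ Superspace.part (V := A) i)
    (hy : y ∈ Superspace.part (V := A) j) :
    LieSuperalgebra.bracket (LieOf.of x) (LieOf.of y) = LieOf.of (x * y - ksign i j • (y * x)) :=
  superCommutator_of_mem (A := A) hx hy

/-- An isomorphism of superalgebras onto a product, considered as an isomorphism of Lie
superalgebras. -/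
def SuperalgEquiv.toLie (e : SuperalgEquiv A ((∀ k, B k) × (∀ k, C k))) :
    LieSuperEquiv (LieOf A) ((∀ k, LieOf (B k)) × (∀ k, LieOf (C k))) :=
  LieSuperEquiv.ofHomogeneous
    ((LieOf.of (A := A)).symm ≪≫ₗ e.toAlgEquiv.toLinearEquiv ≪≫ₗ
      (LinearEquiv.piCongrRight fun k => LieOf.of (A := B k)).prodCongr
        (LinearEquiv.piCongrRight fun k => LieOf.of (A := C k)))
    (fun i x hx => e.map_part i x hx)
    (fun i j x y hx hy => by
      have hx' := e.map_part i x hx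
      have hy' := e.map_part j y hy
      have h := LieOf.bracket_of_mem (A := A) hx hy
      refine (congrArg _ h).trans ?_
      have h' (x y : A) : e.toAlgEquiv (x * y - ksign i j • (y * x)) =
          e.toAlgEquiv x * e.toAlgEquiv y - ksign i j • (e.toAlgEquiv y * e.toAlgEquiv x) := by
        rw [map_sub, map_smul, map_mul, map_mul]
      refine Prod.ext (funext fun k => ?_) (funext fun k => ?_)
      · refine (congrArg (fun z => LieOf.of (z.1 k)) (h' x y)).trans ?_
        exact (LieOf.bracket_of_mem (A := B k) (hx'.1 k trivial) (hy'.1 k trivial)).symm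
      · refine (congrArg (fun z => LieOf.of (z.2 k)) (h' x y)).trans ?_
        exact (LieOf.bracket_of_mem (A := C k) (hx'.2 k trivial) (hy'.2 k trivial)).symm)

theorem SuperalgEquiv.toLie_apply_fst (e : SuperalgEquiv A ((∀ k, B k) × (∀ k, C k))) (a : A)
    (k : ι) : (e.toLie.toLinearEquiv (LieOf.of a)).1 k = LieOf.of ((e.toAlgEquiv a).1 k) := rfl

theorem SuperalgEquiv.toLie_apply_snd (e : SuperalgEquiv A ((∀ k, B k) × (∀ k, C k))) (a : A)
    (k : κ) : (e.toLie.toLinearEquiv (LieOf.of a)).2 k = LieOf.of ((e.toAlgEquiv a).2 k) := rfl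

variable {B₁ : ι → Type*} {C₁ : κ → Type*}
  [∀ k, Ring (B₁ k)] [∀ k, Algebra ℂ (B₁ k)] [∀ k, Superalgebra (B₁ k)]
  [∀ k, Ring (C₁ k)] [∀ k, Algebra ℂ (C₁ k)] [∀ k, Superalgebra (C₁ k)]

/-- The composition of an isomorphism of superalgebras onto a product with isomorphisms of the
factors. -/
def SuperalgEquiv.transProd (e : SuperalgEquiv A ((∀ k, B k) × (∀ k, C k)))
    (q : ∀ k, SuperalgEquiv (B k) (B₁ k)) (m : ∀ k, SuperalgEquiv (C k) (C₁ k)) :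
    SuperalgEquiv A ((∀ k, B₁ k) × (∀ k, C₁ k)) where
  toAlgEquiv := e.toAlgEquiv.trans
    ((AlgEquiv.piCongrRight fun k => (q k).toAlgEquiv).prodCongr
      (AlgEquiv.piCongrRight fun k => (m k).toAlgEquiv))
  map_part i a ha := ⟨fun k _ => (q k).map_part i _ ((e.map_part i a ha).1 k trivial),
    fun k _ => (m k).map_part i _ ((e.map_part i a ha).2 k trivial)⟩

theorem SuperalgEquiv.transProd_apply_fst (e : SuperalgEquiv A ((∀ k, B k) × (∀ k, C k)))
    (q : ∀ k, SuperalgEquiv (B k) (B₁ k)) (m : ∀ k, SuperalgEquiv (C k) (C₁ k)) (a : A) (k : ι) :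
    ((e.transProd q m).toAlgEquiv a).1 k = (q k).toAlgEquiv ((e.toAlgEquiv a).1 k) := rfl

theorem SuperalgEquiv.transProd_apply_snd (e : SuperalgEquiv A ((∀ k, B k) × (∀ k, C k)))
    (q : ∀ k, SuperalgEquiv (B k) (B₁ k)) (m : ∀ k, SuperalgEquiv (C k) (C₁ k)) (a : A) (k : κ) :
    ((e.transProd q m).toAlgEquiv a).2 k = (m k).toAlgEquiv ((e.toAlgEquiv a).2 k) := rfl

end Lie

/-! ### Matrices of endomorphisms of superspaces -/

section Matrices

variable {V : Type*} [AddCommGroup V] [Module ℂ V] [Superspace V] {m k : ℕ}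

/-- The functional `b.coord r ∘ proj j` vanishes on every basis vector, since a basis vector of
degree `j` cannot be `b r`. -/
theorem repr_eq_zero_of_mem (b : Module.Basis (Fin m ⊕ Fin k) ℂ V)
    (hb : ∀ r, b r ∈ Superspace.part (V := V) (blockDeg r)) {j : ZMod 2} {v : V}
    (hv : v ∈ Superspace.part (V := V) j) {r : Fin m ⊕ Fin k} (hr : blockDeg r ≠ j) :
    b.repr v r = 0 := by
  have h : b.coord r ∘ₗ proj j = 0 := by
    refine b.ext fun c => ?_
    rw [LinearMap.comp_apply, LinearMap.zero_apply]
    by_cases hc : blockDeg c = j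
    · rw [proj_of_mem (hc ▸ hb c), Module.Basis.coord_apply, Module.Basis.repr_self,
        Finsupp.single_eq_of_ne]
      rintro rfl
      exact hr hc
    · rw [proj_of_mem_ne (Ne.symm hc) (hb c), map_zero]
  have := LinearMap.congr_fun h v
  rwa [LinearMap.comp_apply, proj_of_mem hv] at this

/-- The matrices with respect to a homogeneous basis. -/
def endEquivMSuper (b : Module.Basis (Fin m ⊕ Fin k) ℂ V)
    (hb : ∀ r, b r ∈ Superspace.part (V := V) (blockDeg r)) :
    SuperalgEquiv (Module.End ℂ V) (MSuper m k) where
  toAlgEquiv := LinearMap.toMatrixAlgEquiv b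
  map_part i f hf r c h := by
    change LinearMap.toMatrixAlgEquiv b f r c = 0
    rw [LinearMap.toMatrixAlgEquiv_apply]
    refine repr_eq_zero_of_mem b hb (hf _ _ (hb c)) fun h' => h ?_
    exact (by decide : ∀ x y i : ZMod 2, x = i + y → x + y = i) _ _ _ h'

/-- The block form of `Q(m)` is recast as a centralizer, so that it can be compared with `QEnd`: the
block swap is the matrix of `J` in an adapted basis. -/
theorem mem_QSuper_iff (M : MSuper m m) :
    M ∈ QSuper m ↔ Matrix.fromBlocks 0 1 1 0 * M = M * Matrix.fromBlocks 0 1 1 0 := by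
  constructor
  · rintro ⟨A, B, rfl⟩
    simp [Matrix.fromBlocks_multiply]
  · intro h
    rw [← Matrix.fromBlocks_toBlocks M] at h ⊢
    simp only [Matrix.fromBlocks_multiply, zero_mul, one_mul, mul_zero, mul_one, zero_add,
      add_zero, Matrix.fromBlocks_inj] at h
    exact ⟨_, _, by rw [h.1, h.2.1]⟩

theorem mem_QEnd_iff (J : OddInvolution V) (θ : Module.End ℂ V) :
    θ ∈ QEnd J ↔ J.toEnd * θ = θ * J.toEnd := by
  rw [QEnd, Subalgebra.mem_centralizer_iff]
  simp

theorem toMatrix_mem_QSuper_iff (J : OddInvolution V) (b : Module.Basis (Fin m ⊕ Fin m) ℂ V)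
    (hJ : ∀ r, J.toEnd (b r) = b r.swap) (θ : Module.End ℂ V) :
    LinearMap.toMatrixAlgEquiv b θ ∈ QSuper m ↔ θ ∈ QEnd J := by
  have h : LinearMap.toMatrixAlgEquiv b J.toEnd = Matrix.fromBlocks 0 1 1 0 := by
    ext r c
    rw [LinearMap.toMatrixAlgEquiv_apply, hJ, Module.Basis.repr_self]
    rcases r with r | r <;> rcases c with c | c <;>
      simp [Finsupp.single_apply, Matrix.one_apply, eq_comm]
  rw [mem_QSuper_iff, mem_QEnd_iff, ← h, ← map_mul, ← map_mul,
    (LinearMap.toMatrixAlgEquiv b).injective.eq_iff]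

/-- The matrices of the endomorphisms that commute with `J`, with respect to a homogeneous basis on
which `J` acts by exchanging the even and the odd elements. -/
def qEndEquivQSuper (J : OddInvolution V) (b : Module.Basis (Fin m ⊕ Fin m) ℂ V)
    (hb : ∀ r, b r ∈ Superspace.part (V := V) (blockDeg r))
    (hJ : ∀ r, J.toEnd (b r) = b r.swap) : SuperalgEquiv (QEnd J) (QSuper m) where
  toFun θ := ⟨LinearMap.toMatrixAlgEquiv b θ.1, (toMatrix_mem_QSuper_iff J b hJ θ.1).2 θ.2⟩
  invFun M := ⟨(LinearMap.toMatrixAlgEquiv b).symm M.1,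
    (toMatrix_mem_QSuper_iff J b hJ _).1 (by rw [AlgEquiv.apply_symm_apply]; exact M.2)⟩
  left_inv θ := Subtype.ext ((LinearMap.toMatrixAlgEquiv b).symm_apply_apply _)
  right_inv M := Subtype.ext ((LinearMap.toMatrixAlgEquiv b).apply_symm_apply _)
  map_mul' θ η := Subtype.ext (map_mul (LinearMap.toMatrixAlgEquiv b) _ _)
  map_add' θ η := Subtype.ext (map_add (LinearMap.toMatrixAlgEquiv b) _ _)
  commutes' r := Subtype.ext ((LinearMap.toMatrixAlgEquiv b).commutes r)
  map_part i θ hθ := (endEquivMSuper b hb).map_part i θ.1 hθ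

/-- A superspace of dimension `m|k` has a homogeneous basis. -/
theorem exists_homogeneous_basis [FiniteDimensional ℂ V]
    (h₀ : Module.finrank ℂ (Superspace.part (V := V) 0) = m)
    (h₁ : Module.finrank ℂ (Superspace.part (V := V) 1) = k) :
    ∃ b : Module.Basis (Fin m ⊕ Fin k) ℂ V, ∀ r, b r ∈ Superspace.part (V := V) (blockDeg r) := by
  refine ⟨((Module.finBasisOfFinrankEq ℂ _ h₀).prod (Module.finBasisOfFinrankEq ℂ _ h₁)).map
    (Submodule.prodEquivOfIsCompl _ _ Superspace.isCompl), ?_⟩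
  rintro (r | r)
  · simp [blockDeg]
  · simp [blockDeg]

/-- An odd involution `J` has a homogeneous basis whose even and odd elements it exchanges. -/
theorem exists_basis_oddInvolution [FiniteDimensional ℂ V] (J : OddInvolution V)
    (h₀ : Module.finrank ℂ (Superspace.part (V := V) 0) = m) :
    ∃ b : Module.Basis (Fin m ⊕ Fin m) ℂ V,
      (∀ r, b r ∈ Superspace.part (V := V) (blockDeg r)) ∧ ∀ r, J.toEnd (b r) = b r.swap := by
  have hJ (v : V) : J.toEnd (J.toEnd v) = v := LinearMap.congr_fun J.sq v
  -- Being odd and its own inverse, `J` identifies the even part with the odd part; a basis of the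
  -- even part followed by its image under `J` is then as required.
  let e : Superspace.part (V := V) 0 ≃ₗ[ℂ] Superspace.part (V := V) 1 :=
    LinearEquiv.ofLinearMap (J.toEnd.restrict fun v hv => J.odd 0 v hv)
      (J.toEnd.restrict fun v hv => J.odd 1 v hv)
      (LinearMap.ext fun v => Subtype.ext (hJ v)) (LinearMap.ext fun v => Subtype.ext (hJ v))
  have he (v : Superspace.part (V := V) 0) : (e v : V) = J.toEnd v := rfl
  let b₀ := Module.finBasisOfFinrankEq ℂ _ h₀
  let b := (b₀.prod (b₀.map e)).map (Submodule.prodEquivOfIsCompl _ _ Superspace.isCompl)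
  have hl (i : Fin m) : b (Sum.inl i) = b₀ i := by simp [b]
  have hr (i : Fin m) : b (Sum.inr i) = J.toEnd (b₀ i) := by simp [b, he]
  refine ⟨b, ?_, ?_⟩
  · rintro (i | i)
    · rw [hl]
      exact (b₀ i).2
    · rw [hr, ← he]
      exact (e (b₀ i)).2
  · rintro (i | i)
    · rw [hl, Sum.swap_inl, hr]
    · rw [hr, Sum.swap_inr, hl, hJ]

end Matrices

/-! ### The supermodules `W^l` -/

section Supermodules

variable {n : ℕ} {T : ∀ l : Ptn n, Tableau l} (φ : Associator T) (l : Ptn n)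

theorem Associator.isTwisted : IsTwisted (φ.toFun l) := isTwisted_of_single (φ.intertwines l)

theorem ksign_add (i j : ZMod 2) : ksign (i + j) 1 = ksign i 1 * ksign j 1 := by
  obtain ⟨-, s₀, -, s₁⟩ := ksign_cases
  rcases (by decide : ∀ i : ZMod 2, i = 0 ∨ i = 1) i with rfl | rfl <;>
    rcases (by decide : ∀ i : ZMod 2, i = 0 ∨ i = 1) j with rfl | rfl <;>
    simp [s₀, s₁, show (1 : ZMod 2) + 1 = 0 from rfl]

theorem ksign_mul_self (i : ZMod 2) : ksign i 1 * ksign i 1 = 1 := by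
  rw [← ksign_add, (by decide : ∀ i : ZMod 2, i + i = 0) i, ksign_cases.2.1]

theorem ksign_ne_zero (i : ZMod 2) : ksign i 1 ≠ 0 := left_ne_zero_of_mul_eq_one (ksign_mul_self i)

theorem Associator.map_smul_of_mem {i : ZMod 2} {a : CS n}
    (ha : a ∈ Superspace.part (V := CS n) i) (v : Specht (T l)) :
    φ.toFun l (a • v) = ksign i 1 • a • φ.toFun l v := by
  rw [φ.isTwisted, signTwist_of_mem ha, smul_assoc]

/-- Moving `a` of degree `i` past `φ` costs `(-1)^i`, exactly the factor by which the sign defining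
the part of degree `i + j` differs from that for `j`. -/
theorem isSupermodule_WE : IsSupermodule (CS n) (WE φ l) := by
  intro i j a w ha hw
  have h : w.2 = ksign j 1 • φ.toFun l w.1 := (mem_wePart φ l j w).1 hw
  refine (mem_wePart φ l (i + j) _).2 ?_
  change a • w.2 = ksign (i + j) 1 • φ.toFun l (a • w.1)
  rw [φ.map_smul_of_mem l ha, h, smul_smul, ksign_add, mul_right_comm, ksign_mul_self, one_mul,
    smul_comm]

variable {l} in
theorem smul_mem_wfPart {i j : ZMod 2} {a : CS n} {u : Specht (T l)}
    (ha : a ∈ Superspace.part (V := CS n) i) (hu : u ∈ wfPart φ l j) :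
    a • u ∈ wfPart φ l (i + j) := by
  have hu' : (φ.toFun l u : CS n) = ksign j 1 • (u : CS n) := hu
  change (φ.toFun l (a • u) : CS n) = ksign (i + j) 1 • ((a • u : Specht (T l)) : CS n)
  rw [φ.map_smul_of_mem l ha, Submodule.coe_smul_of_tower, Submodule.coe_smul, hu',
    Submodule.coe_smul, ksign_add, mul_smul, smul_eq_mul, smul_eq_mul, mul_smul_comm]

theorem isSupermodule_WF (h : l.conj = l) : IsSupermodule (CS n) (WF φ l h) :=
  fun _ _ _ _ ha hu => smul_mem_wfPart φ ha hu

theorem isTypeM_WF (h : l.conj = l) : IsTypeM (CS n) (WF φ l h) := by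
  have hs : IsSimpleModule (CS n) (WF φ l h) := isSimpleModule_specht (T l)
  exact ⟨⟨isSupermodule_WF φ l h, IsSimpleModule.nontrivial (CS n) _, fun U _ =>
    eq_bot_or_eq_top U⟩, hs⟩

variable (T) in
/-- An element of the group algebra that projects the sum of the Specht modules onto one of them. -/
theorem exists_projection : ∃ e : CS n, (∀ v : Specht (T l), e • v = v) ∧
    ∀ m, m ≠ l → ∀ v : Specht (T m), e • v = 0 := by
  classical
  obtain ⟨e, he⟩ := exists_smul_eq T fun m => if m = l then 1 else 0
  refine ⟨e, fun v => ?_, fun m hm v => ?_⟩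
  · rw [he, if_pos rfl, Module.End.one_apply]
  · rw [he, if_neg hm, LinearMap.zero_apply]

variable {l} in
-- A nonzero graded submodule contains a nonzero homogeneous vector, whose two components are both
-- nonzero because `φ` is injective. Elements of the group algebra that project onto either of the
-- two non-isomorphic summands then let this vector generate everything. Without the grading, the
-- first summand is a proper nonzero submodule.
theorem isTypeQ_WE (h : l.conj ≠ l) : IsTypeQ (CS n) (WE φ l) := by
  refine ⟨⟨isSupermodule_WE φ l, ?_, fun U hU => or_iff_not_imp_left.2 fun hU0 => ?_⟩, fun hs => ?_⟩
  · exact inferInstanceAs (Nontrivial (Specht (T l) × Specht (T l.conj)))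
  · obtain ⟨u, hu, hu0⟩ := U.exists_mem_ne_zero_of_ne_bot hU0
    obtain ⟨i, w, hwU, hwi, hw0⟩ : ∃ (i : ZMod 2) (w : WE φ l), w ∈ U ∧
        w ∈ Superspace.part (V := WE φ l) i ∧ w ≠ 0 := by
      by_contra! hc
      have h₀ := hc 0 _ (hU u hu 0) (proj_mem 0 u)
      have h₁ := hc 1 _ (hU u hu 1) (proj_mem 1 u)
      exact hu0 (by rw [← proj_zero_add_proj_one u, h₀, h₁, add_zero])
    have hw : w.2 = ksign i 1 • φ.toFun l w.1 := (mem_wePart φ l i w).1 hwi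
    have hw₁ : w.1 ≠ 0 := by
      intro h₁
      refine hw0 (Prod.ext h₁ ?_)
      rw [hw, h₁, map_zero, smul_zero]
      rfl
    have hw₂ : w.2 ≠ 0 := by
      intro h₂
      rw [h₂] at hw
      exact hw₁ (φ.injective ((smul_eq_zero_iff_right (ksign_ne_zero i)).1 hw.symm))
    obtain ⟨e, he, he'⟩ := exists_projection T l
    obtain ⟨f, hf, hf'⟩ := exists_projection T l.conj
    refine eq_top_iff.2 fun v _ => ?_
    obtain ⟨a, ha⟩ := IsSimpleModule.toSpanSingleton_surjective (CS n) hw₁ v.1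
    obtain ⟨b, hb⟩ := IsSimpleModule.toSpanSingleton_surjective (CS n) hw₂ v.2
    -- The elements `a` and `b` reach the two components of `v` separately; `e` and `f` merge them
    -- into one element, acting as `a` on the first summand and as `b` on the second.
    have hv : v = (e * a + f * b) • w := by
      rw [LinearMap.toSpanSingleton_apply] at ha hb
      refine Prod.ext ?_ ?_
      · change v.1 = (e * a + f * b) • w.1
        rw [add_smul, mul_smul, mul_smul, he, hf' _ h.symm, add_zero, ha]
      · change v.2 = (e * a + f * b) • w.2
        rw [add_smul, mul_smul, mul_smul, hf, he' _ h, zero_add, hb]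
    rw [hv]
    exact U.smul_mem _ hwU
  · have hs' : IsSimpleModule (CS n) (Specht (T l) × Specht (T l.conj)) := hs
    obtain ⟨u, hu⟩ := exists_ne (0 : Specht (T l))
    obtain ⟨v, hv⟩ := exists_ne (0 : Specht (T l.conj))
    rcases eq_bot_or_eq_top ((⊤ : Submodule (CS n) (Specht (T l))).prod
      (⊥ : Submodule (CS n) (Specht (T l.conj)))) with h₁ | h₁
    · have : (u, (0 : Specht (T l.conj))) ∈ (⊤ : Submodule (CS n) (Specht (T l))).prod
        (⊥ : Submodule (CS n) (Specht (T l.conj))) := ⟨trivial, rfl⟩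
      rw [h₁] at this
      exact hu (Prod.ext_iff.1 ((Submodule.mem_bot _).1 this)).1
    · have : ((0 : Specht (T l)), v) ∈ (⊤ : Submodule (CS n) (Specht (T l))).prod
        (⊥ : Submodule (CS n) (Specht (T l.conj))) := h₁ ▸ trivial
      exact hv ((Submodule.mem_bot _).1 this.2)

instance : Module.Finite ℂ (WE φ l) :=
  inferInstanceAs (Module.Finite ℂ (Specht (T l) × Specht (T l.conj)))

instance (h : l.conj = l) : FiniteDimensional ℂ (WF φ l h) :=
  inferInstanceAs (FiniteDimensional ℂ (Specht (T l)))

theorem finrank_wePart (i : ZMod 2) : Module.finrank ℂ (wePart φ l i) = spechtDim T l :=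
  LinearMap.finrank_range_of_inj fun _ _ h => (Prod.ext_iff.1 h).1

theorem finrank_part_WE : Module.finrank ℂ (Superspace.part (V := WE φ l) 0) = spechtDim T l :=
  finrank_wePart φ l 0

/-- The even and the odd part of a supermodule over the group algebra have the same dimension. -/
theorem finrank_part_eq {V : Type*} [AddCommGroup V] [Module ℂ V] [Superspace V] [Module (CS n) V]
    [IsScalarTower ℂ (CS n) V] [FiniteDimensional ℂ V] (hn : 2 ≤ n) (hV : IsSupermodule (CS n) V) :
    Module.finrank ℂ (Superspace.part (V := V) 0) =
      Module.finrank ℂ (Superspace.part (V := V) 1) := by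
  -- An odd permutation of order two exists because `n ≥ 2`; it exchanges the even and the odd part.
  let σ : Equiv.Perm (Fin n) := Equiv.swap ⟨0, by omega⟩ ⟨1, by omega⟩
  have hσ : (single σ 1 : CS n) ∈ Superspace.part (V := CS n) 1 := by
    have hd : permDeg σ = 1 := by
      rw [permDeg, Equiv.Perm.sign_swap (by simp), if_neg (by decide)]
    intro τ hτ
    refine Finsupp.single_eq_of_ne ?_
    rintro rfl
    exact hτ hd
  have hσ' (v : V) : (single σ 1 : CS n) • (single σ 1 : CS n) • v = v := by
    rw [smul_smul, MonoidAlgebra.single_mul_single, Equiv.swap_mul_self, mul_one,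
      ← MonoidAlgebra.one_def, one_smul]
  let f : Module.End ℂ V := Algebra.lsmul ℂ ℂ V (single σ 1 : CS n)
  have hf (v : V) : f (f v) = v := hσ' v
  exact (LinearEquiv.ofLinearMap
    (f.restrict fun v hv => hV 1 0 _ v hσ hv) (f.restrict fun v hv => hV 1 1 _ v hσ hv)
    (LinearMap.ext fun v => Subtype.ext (hf v))
    (LinearMap.ext fun v => Subtype.ext (hf v))).finrank_eq

theorem finrank_part_WF (hn : 2 ≤ n) (h : l.conj = l) :
    Module.finrank ℂ (Superspace.part (V := WF φ l h) 0) +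
      Module.finrank ℂ (Superspace.part (V := WF φ l h) 0) = spechtDim T l := by
  nth_rewrite 2 [finrank_part_eq hn (isSupermodule_WF φ l h)]
  exact Submodule.finrank_add_eq_of_isCompl (Superspace.isCompl (V := WF φ l h))

end Supermodules

/-! ### The decomposition of the group superalgebra -/

section Decomposition

variable {n : ℕ} {T : ∀ l : Ptn n, Tableau l} (φ : Associator T) (P : Set (Ptn n))

theorem lsmul_mem_QEnd (l : Ptn n) (a : CS n) :
    Algebra.lsmul ℂ ℂ (WE φ l) a ∈ QEnd (weInvolution φ l) := by
  rw [mem_QEnd_iff]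
  refine LinearMap.ext fun w => Prod.ext rfl ?_
  change -(a • w.2) = a • (-w.2)
  rw [smul_neg]

/-- The action of the group algebra on the supermodules `W^l`. -/
def actionHom : CS n →ₐ[ℂ] (∀ l : EReps P, QW φ l) × (∀ l : FReps P, EndW φ l) :=
  AlgHom.prod
    (AlgHom.pi fun l : EReps P =>
      (Algebra.lsmul ℂ ℂ (WE φ l.1)).codRestrict (QW φ l) (lsmul_mem_QEnd φ l.1))
    (AlgHom.pi fun l : FReps P => Algebra.lsmul ℂ ℂ (WF φ l.1 l.2.2))

variable {P}

theorem conj_ne_of_mem (hP : IsConjReps P) {l m : Ptn n} (hl : l ∈ P) (hl' : l.conj ≠ l)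
    (hm : m ∈ P) : l.conj ≠ m := by
  rintro rfl
  exact hl' ((hP l).unique ⟨hm, Or.inr rfl⟩ ⟨hl, Or.inl rfl⟩)

theorem conj_injective {l m : Ptn n} (h : l.conj = m.conj) : l = m := by
  rw [← conj_conj l, h, conj_conj]

/-- Every Specht module is a summand of some `W^l` with `l ∈ P`, so faithfulness on the sum of all
Specht modules suffices. -/
theorem actionHom_injective (hP : IsConjReps P) : Function.Injective (actionHom φ P) := by
  refine (injective_iff_map_eq_zero _).2 fun a ha => eq_zero_of_smul_eq_zero T fun m v => ?_
  have hE (l : EReps P) (w : WE φ l.1) : a • w = 0 :=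
    LinearMap.congr_fun (congrArg Subtype.val (congrFun (congrArg Prod.fst ha) l)) w
  have hF (l : FReps P) (w : WF φ l.1 l.2.2) : a • w = 0 :=
    LinearMap.congr_fun (congrFun (congrArg Prod.snd ha) l) w
  obtain ⟨r, ⟨hr, hrm⟩, -⟩ := hP m
  by_cases hc : r.conj = r
  · have : r = m := by
      rcases hrm with rfl | rfl
      · rfl
      · exact conj_injective hc
    subst this
    exact hF ⟨r, hr, hc⟩ v
  · rcases hrm with rfl | h
    · exact congrArg Prod.fst (hE ⟨r, hr, hc⟩ (v, 0))
    · obtain rfl : m = r.conj := by rw [h, conj_conj]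
      exact congrArg Prod.snd (hE ⟨r, hr, hc⟩ (0, v))

theorem spechtCast_self {l : Ptn n} (v : Specht (T l)) : spechtCast T rfl v = v :=
  Subtype.ext (coe_spechtCast T rfl v)

/-- This regroups endomorphisms of the `W^l` into endomorphisms of single Specht modules, the form
that `exists_smul_eq` accepts. Each shape `m` falls under exactly one case: a self-conjugate
representative, another representative, or the conjugate of one. The casts along `h` keep `m`
variable, so that the three clauses can be stated together. -/
theorem exists_family (hP : IsConjReps P) (θ : ∀ l : EReps P, Module.End ℂ (WE φ l.1))
    (η : ∀ l : FReps P, Module.End ℂ (Specht (T l.1))) (m : Ptn n) :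
    ∃ f : Module.End ℂ (Specht (T m)),
      (∀ (l : EReps P) (h : l.1 = m) (v : Specht (T l.1)),
        (f (spechtCast T h v) : CS n) = ((θ l (v, 0)).1 : Specht (T l.1))) ∧
      (∀ (l : EReps P) (h : l.1.conj = m) (v : Specht (T l.1.conj)),
        (f (spechtCast T h v) : CS n) = ((θ l (0, v)).2 : Specht (T l.1.conj))) ∧
      (∀ (l : FReps P) (h : l.1 = m) (v : Specht (T l.1)),
        (f (spechtCast T h v) : CS n) = η l v) := by
  by_cases hm : m ∈ P
  · by_cases hc : m.conj = m
    · refine ⟨η ⟨m, hm, hc⟩, ?_, ?_, ?_⟩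
      · rintro ⟨l, hl, hl'⟩ rfl v
        exact absurd hc hl'
      · rintro ⟨l, hl, hl'⟩ h v
        exact absurd h (conj_ne_of_mem hP hl hl' hm)
      · rintro ⟨l, hl, hl'⟩ rfl v
        rw [spechtCast_self]
    · refine ⟨LinearMap.fst ℂ _ _ ∘ₗ θ ⟨m, hm, hc⟩ ∘ₗ LinearMap.inl ℂ _ _, ?_, ?_, ?_⟩
      · rintro ⟨l, hl, hl'⟩ rfl v
        rw [spechtCast_self]
        rfl
      · rintro ⟨l, hl, hl'⟩ h v
        exact absurd h (conj_ne_of_mem hP hl hl' hm)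
      · rintro ⟨l, hl, hl'⟩ rfl v
        exact absurd hl' hc
  · obtain ⟨k, rfl⟩ : ∃ k : Ptn n, k.conj = m := ⟨_, conj_conj m⟩
    have hk : k ∈ P := by
      obtain ⟨r, ⟨hr, rfl | rfl⟩, -⟩ := hP k
      · exact hr
      · exact absurd hr hm
    have hk' : k.conj ≠ k := fun h => hm (by rwa [h])
    refine ⟨LinearMap.snd ℂ _ _ ∘ₗ θ ⟨k, hk, hk'⟩ ∘ₗ LinearMap.inr ℂ _ _, ?_, ?_, ?_⟩
    · rintro ⟨l, hl, hl'⟩ h v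
      exact absurd (h ▸ hl) hm
    · rintro ⟨l, hl, hl'⟩ h v
      obtain rfl : l = k := conj_injective h
      rw [spechtCast_self]
      rfl
    · rintro ⟨l, hl, hl'⟩ h v
      exact absurd (h ▸ hl) hm

/-- An endomorphism of `X × Y` that commutes with `(x, y) ↦ (x, -y)` is diagonal. -/
theorem apply_eq_of_commute {X Y : Type*} [AddCommGroup X] [Module ℂ X] [AddCommGroup Y]
    [Module ℂ Y] {θ : Module.End ℂ (X × Y)} (hθ : ∀ w, ((θ w).1, -(θ w).2) = θ (w.1, -w.2))
    (w : X × Y) : θ w = ((θ (w.1, 0)).1, (θ (0, w.2)).2) := by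
  have h₁ : (θ (w.1, 0)).2 = 0 := by
    have := congrArg Prod.snd (hθ (w.1, 0))
    rw [neg_zero] at this
    have h : (2 : ℂ) • (θ (w.1, 0)).2 = 0 := by
      rw [two_smul]
      nth_rewrite 1 [← this]
      exact neg_add_cancel _
    exact (smul_eq_zero_iff_right two_ne_zero).1 h
  have h₂ : (θ (0, w.2)).1 = 0 := by
    have := congrArg Prod.fst (hθ (0, w.2))
    rw [show ((0 : X), -w.2) = -((0 : X), w.2) from Prod.ext neg_zero.symm rfl, map_neg] at this
    have h : (2 : ℂ) • (θ (0, w.2)).1 = 0 := by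
      rw [two_smul]
      nth_rewrite 1 [this]
      exact neg_add_cancel _
    exact (smul_eq_zero_iff_right two_ne_zero).1 h
  have hw : w = (w.1, 0) + (0, w.2) := Prod.ext (add_zero _).symm (zero_add _).symm
  conv_lhs => rw [hw, map_add]
  exact Prod.ext (by rw [Prod.fst_add, h₂, add_zero]) (by rw [Prod.snd_add, h₁, zero_add])

theorem QEnd_apply {l : Ptn n} {θ : Module.End ℂ (WE φ l)} (hθ : θ ∈ QEnd (weInvolution φ l))
    (w : WE φ l) : θ w = ((θ (w.1, 0)).1, (θ (0, w.2)).2) :=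
  apply_eq_of_commute (X := Specht (T l)) (Y := Specht (T l.conj))
    (fun w => LinearMap.congr_fun ((mem_QEnd_iff _ _).1 hθ) w) w

/-- An element of `QW φ l` is diagonal on `S^l ⊕ S^{l'}`, hence determined by its two diagonal
blocks; density realizes all blocks by a single element of the group algebra. -/
theorem actionHom_surjective (hP : IsConjReps P) : Function.Surjective (actionHom φ P) := by
  rintro ⟨θ, η⟩
  choose f hE hE' hF using exists_family φ hP (fun l => (θ l).1) η
  obtain ⟨a, ha⟩ := exists_smul_eq T f
  refine ⟨a, Prod.ext (funext fun l => Subtype.ext (LinearMap.ext fun w => ?_))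
    (funext fun l => LinearMap.ext fun w => ?_)⟩
  · refine Eq.trans ?_ (QEnd_apply φ (θ l).2 w).symm
    refine Prod.ext ((ha _ _).trans (Subtype.ext ?_)) ((ha _ _).trans (Subtype.ext ?_))
    · refine Eq.trans ?_ (hE l.1 l rfl w.1)
      rw [spechtCast_self]
    · refine Eq.trans ?_ (hE' l.1.conj l rfl w.2)
      rw [spechtCast_self]
  · refine (ha _ _).trans (Subtype.ext ?_)
    refine Eq.trans ?_ (hF l.1 l rfl w)
    exact congrArg (fun v => (f l.1 v : CS n)) (spechtCast_self (T := T) (l := l.1) w).symm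

/-- The group superalgebra as a product of the superalgebras `Q(W^l)` and `End(W^l)`. -/
def actionEquiv (hP : IsConjReps P) :
    SuperalgEquiv (CS n) ((∀ l : EReps P, QW φ l) × (∀ l : FReps P, EndW φ l)) where
  toAlgEquiv := AlgEquiv.ofBijective (actionHom φ P)
    ⟨actionHom_injective φ hP, actionHom_surjective φ hP⟩
  map_part i a ha := ⟨fun l _ j v hv => isSupermodule_WE φ l.1 i j a v ha hv,
    fun l _ j v hv => isSupermodule_WF φ l.1 l.2.2 i j a v ha hv⟩

end Decomposition

end SymSuper
end

/-! ### The main theorem -/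

theorem mainTheorem3 (n : ℕ) (hn : 2 ≤ n) (P : Set (Ptn n)) (hP : IsConjReps P)
    (T : ∀ l : Ptn n, Tableau l) :
    Nonempty (Associator T) ∧
    ∀ φ : Associator T,
      (∀ l : EReps P, IsTypeQ (CS n) (WE φ l.1)) ∧
      (∀ l : FReps P, IsTypeM (CS n) (WF φ l.1 l.2.2)) ∧
      (∀ l : FReps P, Even (spechtDim T l.1)) ∧
      -- the superalgebra isomorphisms
      ∃ (e : SuperalgEquiv (CS n) ((∀ l : EReps P, QW φ l) × (∀ l : FReps P, EndW φ l)))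
        (q : ∀ l : EReps P, SuperalgEquiv (QW φ l) (QSuper (spechtDim T l.1)))
        (m : ∀ l : FReps P, SuperalgEquiv (EndW φ l)
          (MSuper (spechtDim T l.1 / 2) (spechtDim T l.1 / 2)))
        (e' : SuperalgEquiv (CS n) ((∀ l : EReps P, QSuper (spechtDim T l.1)) ×
          (∀ l : FReps P, MSuper (spechtDim T l.1 / 2) (spechtDim T l.1 / 2))))
        -- the Lie superalgebra isomorphisms
        (g : LieSuperEquiv (LieOf (CS n))
          ((∀ l : EReps P, LieOf (QW φ l)) × (∀ l : FReps P, LieOf (EndW φ l))))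
        (g' : LieSuperEquiv (LieOf (CS n)) ((∀ l : EReps P, LieOf (QSuper (spechtDim T l.1))) ×
          (∀ l : FReps P, LieOf (MSuper (spechtDim T l.1 / 2) (spechtDim T l.1 / 2))))),
        (∀ (a : CS n) (l : EReps P) (w : WE φ l.1),
          ((e.toAlgEquiv a).1 l : Module.End ℂ (WE φ l.1)) w = a • w) ∧
        (∀ (a : CS n) (l : FReps P) (w : WF φ l.1 l.2.2), (e.toAlgEquiv a).2 l w = a • w) ∧
        (∀ (a : CS n) (l : EReps P),
          (e'.toAlgEquiv a).1 l = (q l).toAlgEquiv ((e.toAlgEquiv a).1 l)) ∧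
        (∀ (a : CS n) (l : FReps P),
          (e'.toAlgEquiv a).2 l = (m l).toAlgEquiv ((e.toAlgEquiv a).2 l)) ∧
        (∀ (a : CS n) (l : EReps P),
          (g.toLinearEquiv (LieOf.of a)).1 l = LieOf.of ((e.toAlgEquiv a).1 l)) ∧
        (∀ (a : CS n) (l : FReps P),
          (g.toLinearEquiv (LieOf.of a)).2 l = LieOf.of ((e.toAlgEquiv a).2 l)) ∧
        (∀ (a : CS n) (l : EReps P),
          (g'.toLinearEquiv (LieOf.of a)).1 l = LieOf.of ((e'.toAlgEquiv a).1 l)) ∧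
        (∀ (a : CS n) (l : FReps P),
          (g'.toLinearEquiv (LieOf.of a)).2 l = LieOf.of ((e'.toAlgEquiv a).2 l)) := by
  refine ⟨nonempty_associator hP T, fun φ => ⟨fun l => isTypeQ_WE φ l.2.2,
    fun l => isTypeM_WF φ l.1 l.2.2,
    fun l => ⟨_, (finrank_part_WF φ l.1 hn l.2.2).symm⟩, ?_⟩⟩
  have hq (l : EReps P) : Nonempty (SuperalgEquiv (QW φ l) (QSuper (spechtDim T l.1))) := by
    obtain ⟨b, hb, hJ⟩ := exists_basis_oddInvolution (weInvolution φ l.1) (finrank_part_WE φ l.1)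
    exact ⟨qEndEquivQSuper _ b hb hJ⟩
  have hm (l : FReps P) : Nonempty (SuperalgEquiv (EndW φ l)
      (MSuper (spechtDim T l.1 / 2) (spechtDim T l.1 / 2))) := by
    have h₀ : Module.finrank ℂ (Superspace.part (V := WF φ l.1 l.2.2) 0) = spechtDim T l.1 / 2 := by
      have := finrank_part_WF φ l.1 hn l.2.2
      omega
    obtain ⟨b, hb⟩ := exists_homogeneous_basis h₀
      ((finrank_part_eq hn (isSupermodule_WF φ l.1 l.2.2)).symm.trans h₀)
    exact ⟨endEquivMSuper b hb⟩
  let q l := (hq l).some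
  let m l := (hm l).some
  let e := actionEquiv φ hP
  exact ⟨e, q, m, e.transProd q m, e.toLie, (e.transProd q m).toLie, fun _ _ _ => rfl,
    fun _ _ _ => rfl, e.transProd_apply_fst q m, e.transProd_apply_snd q m, e.toLie_apply_fst,
    e.toLie_apply_snd, (e.transProd q m).toLie_apply_fst, (e.transProd q m).toLie_apply_snd⟩
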